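/- Let $r\neq 0$ be a real number, let $G$ be the Barnes $G$-function, $B_n$ the Bernoulli numbers, and $A$ the Glaisher--Kinkelin constant, $\log A=\frac{\gamma+\log(2\pi)}{12}-\frac{\zeta'(2)}{2\pi^2}$. Put $$\alpha_n(r)=\frac{r\,B_{2n+2}}{2n(2n+1)(2n+2)}\qquad(n\ge 1),$$ and define $b_n(r)$, $n\ge 0$, by the identity of formal power series $$\exp\Big(\sum_{n\ge1}\alpha_n(r)\,x^n\Big)=\sum_{n\ge0}b_n(r)\,x^n ,$$ so that $b_0(r)=1$. Then $$G(z+1)\sim A^{-1}\,z^{-\left(\frac12z^2+\frac12z+\frac1{12}\right)}\,e^{z^2/4}\,\Gamma(z+1)^z\Big(1+\sum_{n\ge1}\frac{b_n(r)}{z^{2n}}\Big)^{1/r}\qquad (z\to\infty,\ |\arg z|<\pi).$$ Here the power of $z$ is the principal one, and $\Gamma(z+1)^z=\exp(z\log\Gamma(z+1))$ with the branch of $\log\Gamma(z+1)$ that is analytic on $\mathbb C\setminus(-\infty,-1]$ and real for real $z>-1$. The relation means that there is a function $R$ such that for every $\delta>0$: for all sufficiently large $|z|$ with $|\arg z|<\pi-\delta$,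 $$G(z+1)=A^{-1}z^{-\left(\frac12z^2+\frac12z+\frac1{12}\right)}e^{z^2/4}\,\Gamma(z+1)^z\,R(z)^{1/r}$$ (principal power of $R(z)$), and for every integer $N\ge 0$ $$R(z)=\sum_{n=0}^{N-1}\frac{b_n(r)}{z^{2n}}+O\big(z^{-2N}\big)\qquad\text{as } z\to\infty \text{ with } |\arg z|<\pi-\delta .$$ Moreover, for every fixed integer $m>0$, $$b_n(r)=\sum_{k=0}^{m-1}b_k(r)\,\frac{r\,B_{2n-2k+2}}{(2n-2k)(2n-2k+1)(2n-2k+2)}+O\!\left(\frac{r\,B_{2n-2m+2}}{(2n-2m)(2n-2m+1)(2n-2m+2)}\right)\qquad\text{as } n\to\infty .$$ -/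

import Mathlib

open Filter Asymptotics
open scoped Topology

noncomputable section

namespace Barnes

/-- The Barnes `G`-function, by its Weierstrass canonical product
`G(w+1) = (2π)^{w/2} exp(-w(w+1)/2 - γ w²/2) ∏_{k≥1} (1 + w/k)^k exp(-w + w²/(2k))`,
taken at `w = z - 1` (the index `k` of the code is `k - 1` in the formula). -/
def G (z : ℂ) : ℂ :=
  (2 * (Real.pi : ℂ)) ^ ((z - 1) / 2) *
    Complex.exp (-((z - 1) * z) / 2 - (Real.eulerMascheroniConstant : ℂ) * (z - 1) ^ 2 / 2) *
    ∏' k : ℕ, ((1 + (z - 1) / ((k : ℂ) + 1)) ^ (k + 1) *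
      Complex.exp (-(z - 1) + (z - 1) ^ 2 / (2 * ((k : ℂ) + 1))))

/-- The Glaisher--Kinkelin constant: `log A = (γ + log (2π)) / 12 - ζ'(2) / (2π²)`. -/
def glaisher : ℝ :=
  Real.exp ((Real.eulerMascheroniConstant + Real.log (2 * Real.pi)) / 12
    - (deriv riemannZeta 2).re / (2 * Real.pi ^ 2))

/-- `log Γ(z+1)`, the branch that is analytic on `ℂ ∖ (-∞, -1]` and real for real `z > -1`,
by the logarithm of the Weierstrass product of `Γ`:
`log Γ(z+1) = -γ z + ∑_{k≥1} (z/k - log (1 + z/k))`, with principal logarithms on the right. -/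
def logGammaAddOne (z : ℂ) : ℂ :=
  -(Real.eulerMascheroniConstant : ℂ) * z +
    ∑' k : ℕ, (z / ((k : ℂ) + 1) - Complex.log (1 + z / ((k : ℂ) + 1)))

theorem summable_logGammaAddOne (z : ℂ) :
    Summable fun k : ℕ => z / ((k : ℂ) + 1) - Complex.log (1 + z / ((k : ℂ) + 1)) := by
  have hs : Summable fun k : ℕ => ‖z‖ ^ 2 * (1 / ((k : ℝ) + 1) ^ 2) := by
    refine Summable.mul_left _ ?_
    have := (summable_nat_add_iff 1).2 (Real.summable_one_div_nat_pow.2 (one_lt_two))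
    simpa using this
  refine Summable.of_norm_bounded_eventually_nat hs ?_
  obtain ⟨K, hK⟩ := exists_nat_ge (2 * ‖z‖)
  filter_upwards [eventually_ge_atTop K] with k hk
  have hk' : (K : ℝ) ≤ k := by exact_mod_cast hk
  have hpos : (0 : ℝ) < (k : ℝ) + 1 := by positivity
  have hn : ‖z / ((k : ℂ) + 1)‖ = ‖z‖ / ((k : ℝ) + 1) := by
    rw [norm_div]
    congr 1
    exact_mod_cast Complex.norm_natCast (k + 1)
  have hhalf : ‖z / ((k : ℂ) + 1)‖ ≤ 1 / 2 := by
    rw [hn, div_le_iff₀ hpos]; linarith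
  have h := Complex.norm_log_one_add_sub_self_le (z := z / ((k : ℂ) + 1)) (by linarith)
  rw [norm_sub_rev]
  refine h.trans ?_
  have h2 : (1 - ‖z / ((k : ℂ) + 1)‖)⁻¹ ≤ 2 := by
    rw [inv_le_comm₀ (by linarith) two_pos]; linarith
  calc ‖z / ((k : ℂ) + 1)‖ ^ 2 * (1 - ‖z / ((k : ℂ) + 1)‖)⁻¹ / 2
      ≤ ‖z / ((k : ℂ) + 1)‖ ^ 2 * 2 / 2 := by gcongr
    _ = ‖z‖ ^ 2 * (1 / ((k : ℝ) + 1) ^ 2) := by rw [hn]; field_simp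

/-- `logGammaAddOne` is a logarithm of `Γ(z+1)`. -/
theorem exp_logGammaAddOne {z : ℂ} (hz : ∀ n : ℕ, z ≠ -((n : ℂ) + 1)) :
    Complex.exp (logGammaAddOne z) = Complex.Gamma (z + 1) := by
  have hk0 : ∀ k : ℕ, (k : ℂ) + 1 ≠ 0 := fun k => by exact_mod_cast k.succ_ne_zero
  have h1 : ∀ k : ℕ, 1 + z / ((k : ℂ) + 1) ≠ 0 := fun k h => hz k (by
    have h' := hk0 k
    field_simp at h
    linear_combination h)
  have hz1 : ∀ k : ℕ, z + 1 + (k : ℂ) ≠ 0 := fun k h => hz k (by linear_combination h)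
  have hL := ((summable_logGammaAddOne z).hasSum.tendsto_sum_nat).comp (tendsto_add_atTop_nat 1)
  have hL' := (Complex.continuous_exp.tendsto _).comp
    (hL.const_add (-(Real.eulerMascheroniConstant : ℂ) * z))
  refine tendsto_nhds_unique hL' ?_
  have hH : Tendsto (fun n : ℕ => Complex.exp (z *
      (((harmonic n - Real.log n : ℝ) : ℂ) - (Real.eulerMascheroniConstant : ℂ)))) atTop
      (𝓝 1) := by
    have h := (Complex.continuous_ofReal.tendsto _).comp Real.tendsto_harmonic_sub_log
    have h' := (Complex.continuous_exp.tendsto _).comp ((h.sub_const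
      (Real.eulerMascheroniConstant : ℂ)).const_mul z)
    simpa [Function.comp_def] using h'
  have hI : Tendsto (fun n : ℕ => Complex.exp (z / ((n : ℂ) + 1)) * (((n : ℂ) + 1) / n)) atTop
      (𝓝 1) := by
    have ha : Tendsto (fun n : ℕ => 1 / ((n : ℂ) + 1)) atTop (𝓝 0) :=
      tendsto_one_div_add_atTop_nhds_zero_nat
    have hb := (Complex.continuous_exp.tendsto _).comp (ha.const_mul z)
    have hc := (tendsto_const_nhds (x := (1 : ℂ))).add
      (tendsto_one_div_atTop_nhds_zero_nat (𝕜 := ℂ))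
    have hd := hb.mul hc
    simp only [mul_zero, Complex.exp_zero, add_zero, mul_one] at hd
    refine hd.congr' ?_
    filter_upwards [eventually_gt_atTop 0] with n hn
    have : (n : ℂ) ≠ 0 := by exact_mod_cast hn.ne'
    simp only [Function.comp_apply]
    congr 1
    · congr 1; ring
    · field_simp
  have hG := (Complex.GammaSeq_tendsto_Gamma (z + 1)).mul (hH.mul hI)
  simp only [mul_one] at hG
  refine hG.congr' ?_
  filter_upwards [eventually_gt_atTop 0] with n hn
  have hn0 : (n : ℂ) ≠ 0 := by exact_mod_cast hn.ne'
  have hprod : ∏ k ∈ Finset.range (n + 1), (1 + z / ((k : ℂ) + 1)) =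
      (∏ k ∈ Finset.range (n + 1), (z + 1 + (k : ℂ))) / ((n + 1).factorial : ℂ) := by
    rw [← Finset.prod_range_add_one_eq_factorial]
    push_cast
    rw [← Finset.prod_div_distrib]
    refine Finset.prod_congr rfl fun k _ => ?_
    have := hk0 k
    field_simp
    ring
  have hharm : ∑ k ∈ Finset.range (n + 1), z / ((k : ℂ) + 1) =
      z * (harmonic n : ℂ) + z / ((n : ℂ) + 1) := by
    rw [Finset.sum_range_succ, harmonic]
    push_cast
    rw [Finset.mul_sum]
    simp only [div_eq_mul_inv]
  have hfac : ((n + 1).factorial : ℂ) = ((n : ℂ) + 1) * (n.factorial : ℂ) := by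
    rw [Nat.factorial_succ]; push_cast; ring
  have hp0 : ∏ k ∈ Finset.range (n + 1), (z + 1 + (k : ℂ)) ≠ 0 :=
    Finset.prod_ne_zero_iff.2 fun k _ => hz1 k
  simp only [Function.comp_apply]
  have hlog : Complex.exp (∑ k ∈ Finset.range (n + 1), Complex.log (1 + z / ((k : ℂ) + 1))) =
      ∏ k ∈ Finset.range (n + 1), (1 + z / ((k : ℂ) + 1)) := by
    rw [Complex.exp_sum]
    exact Finset.prod_congr rfl fun k _ => Complex.exp_log (h1 k)
  rw [Complex.exp_add, Finset.sum_sub_distrib, Complex.exp_sub, hlog, hprod, hharm, hfac,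
    Complex.GammaSeq, Complex.cpow_def_of_ne_zero hn0]
  push_cast
  rw [mul_sub z, mul_sub z, Complex.exp_sub, Complex.exp_sub, Complex.exp_add, mul_add,
    Complex.exp_add, mul_one,
    Complex.exp_log hn0, neg_mul, Complex.exp_neg,
    mul_comm (Real.eulerMascheroniConstant : ℂ) z, mul_comm z (Complex.log n)]
  have e1 := Complex.exp_ne_zero (Complex.log n * z)
  have e2 := Complex.exp_ne_zero (z * (Real.eulerMascheroniConstant : ℂ))
  have hn1 := hk0 n
  field_simp

/-- The factor `A⁻¹ z^{-(z²/2 + z/2 + 1/12)} e^{z²/4} Γ(z+1)^z`, with the principal power of `z`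
and `Γ(z+1)^z = exp (z log Γ(z+1))`. -/
def prefactor (z : ℂ) : ℂ :=
  (glaisher : ℂ)⁻¹ * z ^ (-(z ^ 2 / 2 + z / 2 + 1 / 12)) * Complex.exp (z ^ 2 / 4) *
    Complex.exp (z * logGammaAddOne z)

/-- `α_n(r) = r B_{2n+2} / (2n (2n+1) (2n+2))` for `n ≥ 1`, and `α_0(r) = 0`. -/
def α (r : ℝ) (n : ℕ) : ℝ :=
  if n = 0 then 0
  else r * (bernoulli (2 * n + 2) : ℝ) / ((2 * n : ℝ) * (2 * n + 1) * (2 * n + 2))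

/-- `b_n(r)`, the coefficient of `x^n` in the formal power series `exp (∑_{n≥1} α_n(r) x^n)`. -/
def b (r : ℝ) (n : ℕ) : ℝ :=
  PowerSeries.coeff n ((PowerSeries.exp ℝ).subst (PowerSeries.mk (α r)))

/-- `z → ∞` in the sector `|arg z| < π - δ`. -/
def sectorAtInfinity (δ : ℝ) : Filter ℂ :=
  Bornology.cobounded ℂ ⊓ 𝓟 {z : ℂ | |z.arg| < Real.pi - δ}

/-- `f(z) ~ ∑_{n≥0} c_n z^{-2n}` as `z → ∞` with `|arg z| < π`, in the sense of Poincaré,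
uniformly in every smaller sector `|arg z| < π - δ`. -/
def HasEvenAsymptoticExpansion (f : ℂ → ℂ) (c : ℕ → ℝ) : Prop :=
  ∀ δ : ℝ, 0 < δ → ∀ N : ℕ,
    (fun z : ℂ => f z - ∑ n ∈ Finset.range N, (c n : ℂ) / z ^ (2 * n))
      =O[sectorAtInfinity δ] fun z : ℂ => 1 / z ^ (2 * N)

end Barnes

end

/-! Expansion. Taking logarithms of the canonical products, the factors of `G (z + 1)` and of
`Γ(z+1)^(-z)` combine into terms `(z + k) * log (1 + z / k)`, that is, `(z + k) log (z + k) - (z +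
k) log k` up to the convergence corrections. Euler–Maclaurin sums `w log w`, and the limit of the
remaining elementary sums is known from Stirling's formula, the definition of `γ` and the
hyperfactorial asymptotics. The result, `G_add_one_eq_prefactor_mul`, is exact: `G (z + 1) =
prefactor z * exp (logRemainder 0 z)`, where `logRemainder` is a sum of integral remainders.
Repeated integration by parts gives `logRemainder 0 z` the expansion `∑ α_n(1) z^(-2n)`, because odd
Bernoulli numbers vanish, with errors uniform in the sector because there `‖z + x‖` is comparable to
`‖z‖ + x`. Then `R = exp (r * logRemainder 0)` works: exponentiation of asymptotic series is formal
(`exp_hasExpansion`), and since `logRemainder 0` tends to `0` the principal power `1 / r` undoes the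
factor `r`.

The constant is identified in `tendsto_sum_mul_log_glaisher`: the hyperfactorial constant is `1/12 -
ζ'(-1)`, by continuing the Euler–Maclaurin form of `ζ` to a neighbourhood of `-1`, and the
functional equation turns `ζ'(-1)` into `ζ'(2)`.

Coefficients. By Euler's formula for `ζ(2n+2)`, `|α_n|` is of order `(2n-1)! / (2π)^(2n)`. For such
factorial growth a convolution is dominated by its end terms, so the recurrence `n b_n = ∑ j α_j
b_(n-j)` determines `b_n` up to `O(α_(n-m))` from the terms with `j` or `n - j` below `m`
(`isBigO_coeff_sub_sum_of_recurrence`). -/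

/-! ### Coefficients of the exponential of a rapidly divergent series -/

namespace Barnes

-- In the recurrence the term `j = n` is `n * a n`. By induction the others contribute at most `n *
-- C * |a n| / 2`, so the bound reproduces itself as soon as `C ≥ 2`.
open Finset in
theorem isBigO_coeff_of_recurrence {a c : ℕ → ℝ} (hc0 : c 0 = 1)
    (hrec : ∀ n : ℕ, (n : ℝ) * c n = ∑ j ∈ range (n + 1), (j : ℝ) * a j * c (n - j))
    (ha : ∀ n, n ≠ 0 → a n ≠ 0)
    (hsmall : ∀ᶠ n in atTop, ∑ j ∈ Ico 1 n, |a j| * |a (n - j)| ≤ |a n| / 2) :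
    ∃ C : ℝ, 0 < C ∧ ∀ n, n ≠ 0 → |c n| ≤ C * |a n| := by
  obtain ⟨n₀, hn₀⟩ := eventually_atTop.1 hsmall
  have hS : 0 ≤ ∑ k ∈ range n₀, |c k| / |a k| := sum_nonneg fun k _ => by positivity
  -- The sum settles the indices below `n₀`; the summand `2` gives `1 + C / 2 ≤ C` for the induction
  -- beyond.
  refine ⟨2 + ∑ k ∈ range n₀, |c k| / |a k|, by positivity, fun n => ?_⟩
  set C := 2 + ∑ k ∈ range n₀, |c k| / |a k| with hC
  induction n using Nat.strong_induction_on with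
  | _ n ih =>
    intro hn
    have han : 0 < |a n| := abs_pos.2 (ha n hn)
    rcases lt_or_ge n n₀ with h | h
    · have h1 : |c n| / |a n| ≤ ∑ k ∈ range n₀, |c k| / |a k| :=
        single_le_sum (f := fun k => |c k| / |a k|) (fun k _ => by positivity) (mem_range.2 h)
      rw [← div_le_iff₀ han]
      linarith
    · have hn0 : (0 : ℝ) < n := by exact_mod_cast Nat.pos_of_ne_zero hn
      have h1 : (n : ℝ) * c n = n * a n + ∑ j ∈ Ico 1 n, (j : ℝ) * a j * c (n - j) := by
        rw [hrec, sum_range_succ, range_eq_Ico, sum_eq_sum_Ico_succ_bot (Nat.pos_of_ne_zero hn)]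
        simp [hc0]; ring
      have h2 : |∑ j ∈ Ico 1 n, (j : ℝ) * a j * c (n - j)| ≤
          n * (C * ∑ j ∈ Ico 1 n, |a j| * |a (n - j)|) := by
        refine (abs_sum_le_sum_abs _ _).trans ?_
        rw [mul_sum, mul_sum]
        refine sum_le_sum fun j hj => ?_
        rw [mem_Ico] at hj
        rw [abs_mul, abs_mul, Nat.abs_cast]
        have h3 := ih (n - j) (by omega) (by omega)
        have h4 : (j : ℝ) ≤ n := by exact_mod_cast hj.2.le
        calc (j : ℝ) * |a j| * |c (n - j)| ≤ n * |a j| * (C * |a (n - j)|) := by gcongr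
          _ = _ := by ring
      have h3 : (n : ℝ) * |c n| ≤ n * (|a n| + C * (|a n| / 2)) := by
        rw [← Nat.abs_cast n, ← abs_mul, h1]
        refine (abs_add_le _ _).trans ?_
        rw [abs_mul, mul_add]
        simp only [Nat.abs_cast]
        gcongr
        refine h2.trans ?_
        have := hn₀ n h
        have hCp : 0 ≤ C := by positivity
        gcongr
      have h4 := le_of_mul_le_mul_left h3 hn0
      nlinarith

-- The recurrence is cut into `j < m`, a middle range, and `n - j < m`. The middle is `O(n * a (n -
-- m))` by `hconv`. In the first range `c (n - j)` is replaced by its own expansion with `m - j`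
-- terms, which is available by induction since the factor `j` removes `j = 0`. Regrouped by `l = j
-- + k`, these terms add up to `∑ l * c l * a (n - l)`, which cancels the `-k` in the weights `n -
-- k` of the last range. What remains is `n * ∑ c k * a (n - k)`.
open Finset in
theorem isBigO_coeff_sub_sum_of_recurrence {a c : ℕ → ℝ} (hc0 : c 0 = 1)
    (hrec : ∀ n : ℕ, (n : ℝ) * c n = ∑ j ∈ range (n + 1), (j : ℝ) * a j * c (n - j))
    (ha : ∀ n, n ≠ 0 → a n ≠ 0)
    (hsmall : ∀ᶠ n in atTop, ∑ j ∈ Ico 1 n, |a j| * |a (n - j)| ≤ |a n| / 2)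
    (hconv : ∀ m : ℕ, 0 < m →
      (fun n : ℕ => ∑ j ∈ Ico m (n + 1 - m), |a j| * |a (n - j)|) =O[atTop] fun n => a (n - m))
    (m : ℕ) (hm : 0 < m) :
    (fun n : ℕ => c n - ∑ k ∈ range m, c k * a (n - k)) =O[atTop] fun n => a (n - m) := by
  obtain ⟨C, hC, hca⟩ := isBigO_coeff_of_recurrence hc0 hrec ha hsmall
  induction m using Nat.strong_induction_on with
  | _ m ih =>
    have herr : (fun n : ℕ => ∑ j ∈ range m, (j : ℝ) * a j *
        (c (n - j) - ∑ k ∈ range (m - j), c k * a (n - j - k))) =O[atTop] fun n => a (n - m) := by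
      refine IsBigO.fun_sum fun j hj => ?_
      rw [mem_range] at hj
      rcases Nat.eq_zero_or_pos j with rfl | hj0
      · simpa using isBigO_zero _ _
      · have h := (ih (m - j) (by omega) (by omega)).comp_tendsto (tendsto_sub_atTop_nat j)
        refine (IsBigO.const_mul_left ?_ _)
        refine h.congr (fun n => rfl) fun n => ?_
        simp only [Function.comp_apply]
        congr 1; omega
    have hmid : (fun n : ℕ => ∑ j ∈ Ico m (n + 1 - m), (j : ℝ) * a j * c (n - j)) =O[atTop]
        fun n => (n : ℝ) * a (n - m) := by
      have h : (fun n : ℕ => ∑ j ∈ Ico m (n + 1 - m), (j : ℝ) * a j * c (n - j)) =O[atTop]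
          fun n => (n : ℝ) * ∑ j ∈ Ico m (n + 1 - m), |a j| * |a (n - j)| := by
        refine IsBigO.of_bound C (Eventually.of_forall fun n => ?_)
        have hnn : 0 ≤ ∑ j ∈ Ico m (n + 1 - m), |a j| * |a (n - j)| :=
          sum_nonneg fun j _ => by positivity
        rw [Real.norm_eq_abs, Real.norm_eq_abs, abs_mul (n : ℝ), Nat.abs_cast,
          abs_of_nonneg hnn, mul_sum, mul_sum]
        refine (abs_sum_le_sum_abs _ _).trans (sum_le_sum fun j hj => ?_)
        rw [mem_Ico] at hj
        rw [abs_mul, abs_mul, Nat.abs_cast]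
        have h3 := hca (n - j) (by omega)
        have h4 : (j : ℝ) ≤ n := by exact_mod_cast (by omega : j ≤ n)
        calc (j : ℝ) * |a j| * |c (n - j)| ≤ n * |a j| * (C * |a (n - j)|) := by gcongr
          _ = _ := by ring
      exact h.trans ((isBigO_refl _ _).mul (hconv m hm))
    have hle : (fun n : ℕ => a (n - m)) =O[atTop] fun n : ℕ => (n : ℝ) * a (n - m) := by
      refine IsBigO.of_bound 1 ?_
      filter_upwards [eventually_ge_atTop 1] with n hn
      have : (1 : ℝ) ≤ n := by exact_mod_cast hn
      rw [norm_mul, one_mul, Real.norm_natCast]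
      exact le_mul_of_one_le_left (norm_nonneg _) this
    have herr' := herr.trans hle
    have hkey : (fun n : ℕ => (n : ℝ) * (c n - ∑ k ∈ range m, c k * a (n - k))) =O[atTop]
        fun n => (n : ℝ) * a (n - m) := by
      refine (hmid.add herr').congr' ?_ EventuallyEq.rfl
      filter_upwards [eventually_ge_atTop (2 * m)] with n hn
      -- Here the recurrence is used backwards, at each `l < m`, to sum the inner convolution.
      have h1 : ∑ j ∈ range m, (j : ℝ) * a j * ∑ k ∈ range (m - j), c k * a (n - j - k) =
          ∑ l ∈ range m, (l : ℝ) * c l * a (n - l) := by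
        simp_rw [mul_sum]
        rw [← sum_range_diag_flip m fun j k => (j : ℝ) * a j * (c k * a (n - j - k))]
        refine sum_congr rfl fun l hl => ?_
        rw [hrec, sum_mul]
        refine sum_congr rfl fun j hj => ?_
        rw [mem_range] at hj
        rw [show n - j - (l - j) = n - l by omega]
        ring
      have h2 : ∑ j ∈ Ico (n + 1 - m) (n + 1), (j : ℝ) * a j * c (n - j) =
          ∑ k ∈ range m, ((n : ℝ) - k) * a (n - k) * c k := by
        have := sum_Ico_reflect (fun j => (j : ℝ) * a j * c (n - j)) 0 (m := m) (n := n) (by omega)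
        rw [Nat.sub_zero] at this
        rw [← this, range_eq_Ico]
        refine sum_congr rfl fun k hk => ?_
        rw [mem_Ico] at hk
        rw [show n - (n - k) = k by omega, Nat.cast_sub (by omega)]
      have h3 : (n : ℝ) * c n = ∑ j ∈ range m, (j : ℝ) * a j * c (n - j) +
          ∑ j ∈ Ico m (n + 1 - m), (j : ℝ) * a j * c (n - j) +
          ∑ k ∈ range m, ((n : ℝ) - k) * a (n - k) * c k := by
        rw [hrec, ← h2, range_eq_Ico, range_eq_Ico, sum_Ico_consecutive _ (by omega) (by omega),
          sum_Ico_consecutive _ (by omega) (by omega)]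
      simp_rw [mul_sub ((_ : ℝ) * a _), sum_sub_distrib]
      rw [h1, mul_sub, h3, mul_sum]
      have h4 : ∑ k ∈ range m, ((n : ℝ) - k) * a (n - k) * c k =
          ∑ k ∈ range m, (n : ℝ) * (c k * a (n - k)) - ∑ l ∈ range m, (l : ℝ) * c l * a (n - l) := by
        rw [← sum_sub_distrib]
        exact sum_congr rfl fun k _ => by ring
      rw [h4]; ring
    obtain ⟨K, hK⟩ := hkey.bound
    refine IsBigO.of_bound K ?_
    filter_upwards [hK, eventually_gt_atTop 0] with n hn hn0
    have hn0' : (0 : ℝ) < n := by exact_mod_cast hn0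
    rw [norm_mul, norm_mul, Real.norm_natCast] at hn
    refine le_of_mul_le_mul_left ?_ hn0'
    linarith

/-! ### Factorial growth of `α` -/

theorem factorial_mul_factorial_le {m q : ℕ} (t : ℕ) (h : m ≤ q) :
    (m + t).factorial * q.factorial ≤ m.factorial * (q + t).factorial := by
  induction t with
  | zero => simp
  | succ t ih =>
    rw [← add_assoc, ← add_assoc, Nat.factorial_succ, Nat.factorial_succ]
    calc (m + t + 1) * (m + t).factorial * q.factorial
        = (m + t + 1) * ((m + t).factorial * q.factorial) := by ring
      _ ≤ (q + t + 1) * (m.factorial * (q + t).factorial) := by gcongr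
      _ = _ := by ring

theorem factorial_mul_factorial_le' {m j n : ℕ} (hm : 0 < m) (h1 : m ≤ j) (h2 : m ≤ n - j) :
    (2 * j - 1).factorial * (2 * (n - j) - 1).factorial ≤
      (2 * m - 1).factorial * (2 * (n - m) - 1).factorial := by
  have := factorial_mul_factorial_le (m := 2 * m - 1) (q := 2 * (n - j) - 1) (2 * (j - m)) (by omega)
  rwa [show 2 * m - 1 + 2 * (j - m) = 2 * j - 1 by omega,
    show 2 * (n - j) - 1 + 2 * (j - m) = 2 * (n - m) - 1 by omega] at this

-- By log-convexity of the factorial the two end terms `D` are the largest, and all others are at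
-- most `E`, the value at `j = m + 1`. There are fewer than `n` of these up to a constant, and `E`
-- is smaller than the end terms by a factor of order `n ^ 2`.
open Finset in
theorem sum_factorial_mul_factorial_le {m n : ℕ} (hm : 0 < m) (hn : 2 * m + 2 ≤ n) :
    ∑ j ∈ Ico m (n + 1 - m), (2 * j - 1).factorial * (2 * (n - j) - 1).factorial ≤
      (2 * (2 * m - 1).factorial + (2 * m + 1).factorial) * (2 * (n - m) - 1).factorial := by
  set D := (2 * m - 1).factorial * (2 * (n - m) - 1).factorial with hD
  set E := (2 * m + 1).factorial * (2 * (n - m - 1) - 1).factorial with hE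
  have h1 : ∀ j ∈ Ico m (n + 1 - m), (2 * j - 1).factorial * (2 * (n - j) - 1).factorial ≤
      (if j = m then D else 0) + (if j = n - m then D else 0) + E := by
    intro j hj
    rw [mem_Ico] at hj
    rcases eq_or_ne j m with rfl | h
    · simp only [if_true]
      omega
    rcases eq_or_ne j (n - m) with rfl | h'
    · have := factorial_mul_factorial_le' (j := n - m) (n := n) hm (by omega) (by omega)
      simp only [if_true]
      omega
    · have := factorial_mul_factorial_le' (m := m + 1) (j := j) (n := n)
        (by omega) (by omega) (by omega)
      rw [show 2 * (m + 1) - 1 = 2 * m + 1 by omega, show n - (m + 1) = n - m - 1 by omega] at this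
      omega
  refine (sum_le_sum h1).trans ?_
  rw [sum_add_distrib, sum_add_distrib, sum_const, Nat.card_Ico, smul_eq_mul]
  have h2 : ∑ j ∈ Ico m (n + 1 - m), (if j = m then D else 0) ≤ D := by
    rw [sum_ite_eq']; split_ifs <;> simp
  have h3 : ∑ j ∈ Ico m (n + 1 - m), (if j = n - m then D else 0) ≤ D := by
    rw [sum_ite_eq']; split_ifs <;> simp
  have h4 : (n + 1 - m - m) * E ≤ (2 * m + 1).factorial * (2 * (n - m) - 1).factorial := by
    obtain ⟨s, rfl⟩ := Nat.exists_eq_add_of_le hn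
    have e1 : 2 * (2 * m + 2 + s - m) - 1 = (2 * (2 * m + 2 + s - m - 1) - 1) + 1 + 1 := by omega
    set p := 2 * (2 * m + 2 + s - m - 1) - 1 with hp
    rw [hE, e1, Nat.factorial_succ (p + 1), Nat.factorial_succ p]
    set f := p.factorial
    calc (2 * m + 2 + s + 1 - m - m) * ((2 * m + 1).factorial * f)
        = (2 * m + 1).factorial * ((2 * m + 2 + s + 1 - m - m) * f) := by ring
      _ ≤ (2 * m + 1).factorial * ((p + 1 + 1) * (1 * f)) := by
          rw [one_mul]
          exact Nat.mul_le_mul_left _ (Nat.mul_le_mul_right _ (by omega))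
      _ ≤ _ := Nat.mul_le_mul_left _ (Nat.mul_le_mul_left _ (Nat.mul_le_mul_right _ (by omega)))
  calc _ ≤ D + D + (2 * m + 1).factorial * (2 * (n - m) - 1).factorial := by omega
    _ = _ := by rw [hD]; ring

/-- `|B_{2n+2}| / (2n (2n+1) (2n+2))` has the size of `(2n-1)! / (2π)^{2n}`. -/
theorem abs_α_eq (r : ℝ) {n : ℕ} (hn : n ≠ 0) :
    |α r n| = |r| * 2 / (2 * Real.pi) ^ 2 * (∑' k : ℕ, 1 / (k : ℝ) ^ (2 * (n + 1))) *
      ((2 * n - 1).factorial / ((2 * Real.pi) ^ 2) ^ n) := by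
  have h := (hasSum_zeta_nat (k := n + 1) (by omega)).tsum_eq
  obtain ⟨k, rfl⟩ := Nat.exists_eq_succ_of_ne_zero hn
  have hf : ((2 * (k.succ + 1)).factorial : ℝ) = (2 * k.succ + 2) * (2 * k.succ + 1) *
      (2 * k.succ) * (2 * k.succ - 1).factorial := by
    rw [show 2 * (k.succ + 1) = (2 * k.succ - 1) + 1 + 1 + 1 by omega, Nat.factorial_succ,
      Nat.factorial_succ, Nat.factorial_succ, show 2 * k.succ - 1 = 2 * k + 1 by omega]
    push_cast; ring
  have hz : (0 : ℝ) ≤ ∑' i : ℕ, 1 / (i : ℝ) ^ (2 * (k.succ + 1)) :=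
    tsum_nonneg fun i => by positivity
  have hz'' := congrArg abs h
  rw [abs_of_nonneg hz] at hz''
  rw [hz'']
  rw [α, if_neg hn]
  simp only [abs_mul, abs_div, abs_pow, abs_neg, abs_one, one_pow, one_mul, Nat.abs_cast]
  rw [hf, show 2 * (k.succ + 1) - 1 = 2 * k + 3 by omega, show 2 * k.succ + 2 = 2 * (k.succ + 1) by ring]
  have hp := Real.pi_pos
  rw [abs_of_pos hp, abs_of_pos (by positivity : (0:ℝ) < 2 * k.succ + 1),
    abs_of_pos (by positivity : (0:ℝ) < 2 * k.succ + 2), abs_two]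
  have hfp : ((2 * k.succ - 1).factorial : ℝ) ≠ 0 := by positivity
  rw [mul_pow, mul_pow]
  simp only [Nat.succ_eq_add_one]
  push_cast
  field_simp
  have h4 : (2 : ℝ) ^ (k * 2) = 4 ^ k := by rw [mul_comm, pow_mul]; norm_num
  ring_nf
  rw [h4]

theorem one_le_tsum_one_div_pow (n : ℕ) :
    1 ≤ ∑' k : ℕ, 1 / (k : ℝ) ^ (2 * (n + 1)) := by
  have hs : Summable fun k : ℕ => 1 / (k : ℝ) ^ (2 * (n + 1)) :=
    Real.summable_one_div_nat_pow.2 (by omega)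
  have := hs.le_tsum 1 fun k _ => by positivity
  simpa using this

theorem tsum_one_div_pow_le (n : ℕ) :
    ∑' k : ℕ, 1 / (k : ℝ) ^ (2 * (n + 1)) ≤ ∑' k : ℕ, 1 / (k : ℝ) ^ 2 := by
  refine Summable.tsum_le_tsum (fun k => ?_) (Real.summable_one_div_nat_pow.2 (by omega))
    (Real.summable_one_div_nat_pow.2 (by omega))
  rcases Nat.eq_zero_or_pos k with rfl | hk
  · simp
  · have : (1 : ℝ) ≤ k := by exact_mod_cast hk
    gcongr
    omega

/-- The zeta factor in `abs_α_eq` lies between `1` and `ζ(2)`. -/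
theorem α_bounds {r : ℝ} (hr : r ≠ 0) : ∃ c C : ℝ, 0 < c ∧ 0 < C ∧ ∀ n, n ≠ 0 →
    c * ((2 * n - 1).factorial / ((2 * Real.pi) ^ 2) ^ n) ≤ |α r n| ∧
      |α r n| ≤ C * ((2 * n - 1).factorial / ((2 * Real.pi) ^ 2) ^ n) := by
  have hp := Real.pi_pos
  have hr' := abs_pos.2 hr
  have hZ : 0 < ∑' k : ℕ, 1 / (k : ℝ) ^ 2 :=
    zero_lt_one.trans_le (by simpa using one_le_tsum_one_div_pow 0)
  refine ⟨|r| * 2 / (2 * Real.pi) ^ 2, |r| * 2 / (2 * Real.pi) ^ 2 * ∑' k : ℕ, 1 / (k : ℝ) ^ 2,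
    by positivity, by positivity, fun n hn => ?_⟩
  rw [abs_α_eq r hn]
  have h1 := one_le_tsum_one_div_pow n
  have h2 := tsum_one_div_pow_le n
  constructor
  · gcongr
    exact le_mul_of_one_le_right (by positivity) h1
  · gcongr

theorem α_ne_zero {r : ℝ} (hr : r ≠ 0) {n : ℕ} (hn : n ≠ 0) : α r n ≠ 0 := by
  obtain ⟨c, C, hc, -, h⟩ := α_bounds hr
  have := (h n hn).1
  refine abs_pos.1 (lt_of_lt_of_le ?_ this)
  have := Real.pi_pos
  positivity

open Finset in
theorem isBigO_convolution_α {r : ℝ} (hr : r ≠ 0) {m : ℕ} (hm : 0 < m) :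
    (fun n : ℕ => ∑ j ∈ Ico m (n + 1 - m), |α r j| * |α r (n - j)|) =O[atTop]
      fun n => α r (n - m) := by
  obtain ⟨c, C, hc, hC, h⟩ := α_bounds hr
  set q := (2 * Real.pi) ^ 2 with hq
  have hqp : 0 < q := by have := Real.pi_pos; positivity
  set K : ℕ := 2 * (2 * m - 1).factorial + (2 * m + 1).factorial
  refine IsBigO.of_bound (C ^ 2 * K / q ^ m / c) ?_
  filter_upwards [eventually_ge_atTop (2 * m + 2)] with n hn
  rw [Real.norm_eq_abs, abs_of_nonneg (sum_nonneg fun j _ => by positivity), Real.norm_eq_abs]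
  have h1 : ∑ j ∈ Ico m (n + 1 - m), |α r j| * |α r (n - j)| ≤
      ∑ j ∈ Ico m (n + 1 - m), C ^ 2 / q ^ n *
        (((2 * j - 1).factorial * (2 * (n - j) - 1).factorial : ℕ) : ℝ) := by
    refine sum_le_sum fun j hj => ?_
    rw [mem_Ico] at hj
    have hpow : q ^ n = q ^ j * q ^ (n - j) := by rw [← pow_add]; congr 1; omega
    calc |α r j| * |α r (n - j)| ≤ (C * ((2 * j - 1).factorial / q ^ j)) *
          (C * ((2 * (n - j) - 1).factorial / q ^ (n - j))) :=
          mul_le_mul (h j (by omega)).2 (h (n - j) (by omega)).2 (abs_nonneg _) (by positivity)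
      _ = _ := by rw [hpow]; push_cast; field_simp
  refine h1.trans ?_
  rw [← mul_sum, ← Nat.cast_sum]
  have h2 : ((∑ j ∈ Ico m (n + 1 - m), (2 * j - 1).factorial * (2 * (n - j) - 1).factorial : ℕ) : ℝ)
      ≤ K * (2 * (n - m) - 1).factorial := by
    exact_mod_cast sum_factorial_mul_factorial_le hm hn
  have h3 := (h (n - m) (by omega)).1
  have hpow : q ^ n = q ^ m * q ^ (n - m) := by rw [← pow_add]; congr 1; omega
  calc _ ≤ C ^ 2 / q ^ n * (K * (2 * (n - m) - 1).factorial) := by gcongr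
    _ = C ^ 2 * K / q ^ m / c * (c * ((2 * (n - m) - 1).factorial / q ^ (n - m))) := by
      rw [hpow]; field_simp
    _ ≤ _ := by gcongr

/-- The quotient is of order `(2π)^2 / ((2n-1)(2n-2))`. With `m = 1` in `isBigO_convolution_α` this
yields the smallness hypothesis of the recurrence lemmas. -/
theorem isLittleO_α {r : ℝ} (hr : r ≠ 0) :
    (fun n : ℕ => α r (n - 1)) =o[atTop] α r := by
  obtain ⟨c, C, hc, hC, h⟩ := α_bounds hr
  set q := (2 * Real.pi) ^ 2 with hq
  have hqp : 0 < q := by have := Real.pi_pos; positivity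
  refine IsLittleO.of_bound fun ε hε => ?_
  obtain ⟨N, hN⟩ := exists_nat_ge (C * q / (c * ε))
  filter_upwards [eventually_ge_atTop (N + 2)] with n hn
  obtain ⟨k, rfl⟩ : ∃ k, n = k + 2 := ⟨n - 2, by omega⟩
  have h1 := (h (k + 2 - 1) (by omega)).2
  have h2 := (h (k + 2) (by omega)).1
  rw [Real.norm_eq_abs, Real.norm_eq_abs]
  refine h1.trans (le_trans ?_ (mul_le_mul_of_nonneg_left h2 hε.le))
  rw [show 2 * (k + 2) - 1 = (2 * k + 1) + 1 + 1 by omega, Nat.factorial_succ, Nat.factorial_succ,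
    show 2 * (k + 2 - 1) - 1 = 2 * k + 1 by omega, show k + 2 - 1 = k + 1 by omega]
  rw [div_le_iff₀ (by positivity)] at hN
  have hk : (N : ℝ) ≤ k := by exact_mod_cast (by omega : N ≤ k)
  have hk' : (N : ℝ) ≤ ((2 * k + 1 + 1 + 1 : ℕ) : ℝ) * ((2 * k + 1 + 1 : ℕ) : ℝ) := by
    push_cast; nlinarith
  have hkey : C * q ≤ ((2 * k + 1 + 1 + 1 : ℕ) : ℝ) * ((2 * k + 1 + 1 : ℕ) : ℝ) * (c * ε) :=
    hN.trans (by gcongr)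
  set F : ℝ := ((2 * k + 1).factorial : ℝ) with hF
  have hFp : 0 < F := by rw [hF]; positivity
  rw [Nat.cast_mul, Nat.cast_mul, ← hF]
  calc C * (F / q ^ (k + 1)) = C * q * (F / q ^ (k + 2)) := by rw [pow_succ q (k + 1)]; field_simp
    _ ≤ (((2 * k + 1 + 1 + 1 : ℕ) : ℝ) * ((2 * k + 1 + 1 : ℕ) : ℝ) * (c * ε)) * (F / q ^ (k + 2)) := by
      gcongr
    _ = _ := by ring

/-! ### The coefficients `b` -/

theorem hasSubst_mk_α (r : ℝ) : PowerSeries.HasSubst (PowerSeries.mk (α r)) :=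
  PowerSeries.HasSubst.of_constantCoeff_zero' (by
    rw [← PowerSeries.coeff_zero_eq_constantCoeff_apply, PowerSeries.coeff_mk, α, if_pos rfl])

theorem b_zero (r : ℝ) : b r 0 = 1 := by
  rw [b, PowerSeries.coeff_subst' (hasSubst_mk_α r), finsum_eq_single _ 0]
  · simp
  · intro d hd
    simp [α, hd]

-- Coefficient comparison in `(exp ∘ A)' = A' * (exp ∘ A)`.
open Finset in
theorem b_recurrence (r : ℝ) (n : ℕ) :
    (n : ℝ) * b r n = ∑ j ∈ range (n + 1), (j : ℝ) * α r j * b r (n - j) := by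
  rcases n with _ | n
  · simp
  have h := congrArg (PowerSeries.coeff n) (PowerSeries.derivative_subst
    (f := PowerSeries.exp ℝ) (hasSubst_mk_α r))
  rw [PowerSeries.derivative_exp, PowerSeries.coeff_derivative, mul_comm _ (PowerSeries.derivative ℝ _),
    PowerSeries.coeff_mul, Nat.sum_antidiagonal_eq_sum_range_succ_mk] at h
  simp only [PowerSeries.coeff_derivative, PowerSeries.coeff_mk] at h
  rw [sum_range_succ']
  simp only [Nat.cast_zero, zero_mul, add_zero, Nat.reduceSubDiff]
  rw [b, mul_comm]
  push_cast
  rw [h]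
  refine sum_congr rfl fun j _ => ?_
  rw [b]; ring

open Finset in
theorem isBigO_b_sub_sum {r : ℝ} (hr : r ≠ 0) (m : ℕ) (hm : 0 < m) :
    (fun n : ℕ => b r n - ∑ k ∈ range m, b r k * α r (n - k)) =O[atTop]
      fun n : ℕ => α r (n - m) := by
  refine isBigO_coeff_sub_sum_of_recurrence (b_zero r) (b_recurrence r)
    (fun n hn => α_ne_zero hr hn) ?_ (fun m hm => isBigO_convolution_α hr hm) m hm
  have h := (isBigO_convolution_α hr one_pos).trans_isLittleO (isLittleO_α hr)
  filter_upwards [h.bound (half_pos one_pos)] with n hn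
  rw [Real.norm_eq_abs, abs_of_nonneg (sum_nonneg fun j _ => by positivity), Real.norm_eq_abs,
    Nat.add_sub_cancel] at hn
  linarith

end Barnes

/-! ### Euler–Maclaurin on the unit interval -/

noncomputable section
namespace Barnes

/-- The remainder term `∫₀¹ B_p(x)/p! f(x) dx` of the Euler--Maclaurin formula on `[0, 1]`. -/
def emInt (p : ℕ) (f : ℝ → ℂ) : ℂ :=
  ∫ x in (0 : ℝ)..1, f x * ((bernoulliFun p x / p.factorial : ℝ) : ℂ)

/-- Integration by parts, since `B_(p+1) / (p+1)!` has derivative `B_p / p!`. -/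
theorem emInt_eq_sub_emInt_succ (p : ℕ) {f f' : ℝ → ℂ}
    (hf : ∀ x ∈ Set.Icc (0 : ℝ) 1, HasDerivAt f (f' x) x)
    (hf' : ContinuousOn f' (Set.Icc 0 1)) :
    emInt p f = f 1 * ((bernoulliFun (p + 1) 1 / (p + 1).factorial : ℝ) : ℂ) -
      f 0 * ((bernoulliFun (p + 1) 0 / (p + 1).factorial : ℝ) : ℂ) - emInt (p + 1) f' := by
  have hI : Set.uIcc (0 : ℝ) 1 = Set.Icc 0 1 := Set.uIcc_of_le zero_le_one
  have h := intervalIntegral.integral_mul_deriv_eq_deriv_mul (a := (0 : ℝ)) (b := 1) (u := f)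
    (u' := f') (v := fun x => ((bernoulliFun (p + 1) x / (p + 1).factorial : ℝ) : ℂ))
    (v' := fun x => ((bernoulliFun p x / p.factorial : ℝ) : ℂ))
    (by rw [hI]; exact hf)
    (fun x _ => by
      have h1 := ((hasDerivAt_bernoulliFun (p + 1) x).div_const ((p + 1).factorial : ℝ)).ofReal_comp
      convert! h1 using 2
      rw [Nat.factorial_succ, Nat.add_sub_cancel]
      push_cast
      field_simp)
    (ContinuousOn.intervalIntegrable (by rwa [hI]))
    (Continuous.intervalIntegrable (by
      have := continuous_bernoulliFun p
      fun_prop) _ _)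
  exact h

theorem exists_norm_emInt_le (p : ℕ) : ∃ M : ℝ, 0 < M ∧ ∀ (f : ℝ → ℂ) (C : ℝ),
    (∀ x ∈ Set.Icc (0 : ℝ) 1, ‖f x‖ ≤ C) → ‖emInt p f‖ ≤ M * C := by
  obtain ⟨M, hM⟩ := (isCompact_Icc (a := (0 : ℝ)) (b := 1)).exists_bound_of_continuousOn
    ((continuous_bernoulliFun p).div_const (p.factorial : ℝ)).continuousOn
  have hM0 : 0 ≤ M := (norm_nonneg _).trans (hM 0 (by simp))
  refine ⟨M + 1, by linarith, fun f C hf => ?_⟩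
  have hC : 0 ≤ C := (norm_nonneg _).trans (hf 0 (by simp))
  have h := intervalIntegral.norm_integral_le_of_norm_le_const (a := (0 : ℝ)) (b := 1)
    (f := fun x => f x * ((bernoulliFun p x / p.factorial : ℝ) : ℂ)) (C := (M + 1) * C)
    (fun x hx => by
      rw [Set.uIoc_of_le zero_le_one] at hx
      have hx' : x ∈ Set.Icc (0 : ℝ) 1 := ⟨hx.1.le, hx.2⟩
      rw [norm_mul, Complex.norm_real, mul_comm]
      exact mul_le_mul ((hM x hx').trans (by linarith)) (hf x hx') (norm_nonneg _) (by linarith))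
  rwa [sub_zero, abs_one, mul_one] at h

theorem emInt_zero {f P : ℝ → ℂ} (hP : ∀ x ∈ Set.Icc (0 : ℝ) 1, HasDerivAt P (f x) x)
    (hf : ContinuousOn f (Set.Icc 0 1)) : emInt 0 f = P 1 - P 0 := by
  have hI : Set.uIcc (0 : ℝ) 1 = Set.Icc 0 1 := Set.uIcc_of_le zero_le_one
  simp only [emInt, bernoulliFun_zero, Nat.factorial_zero, Nat.cast_one, div_one,
    Complex.ofReal_one, mul_one]
  exact intervalIntegral.integral_eq_sub_of_hasDerivAt (by rwa [hI])
    (ContinuousOn.intervalIntegrable (by rwa [hI]))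

/-- The Euler--Maclaurin formula on `[0, 1]` with a third-order remainder. -/
theorem eulerMaclaurin_third_order {P f f₁ f₂ f₃ : ℝ → ℂ}
    (hP : ∀ x ∈ Set.Icc (0 : ℝ) 1, HasDerivAt P (f x) x)
    (hf : ∀ x ∈ Set.Icc (0 : ℝ) 1, HasDerivAt f (f₁ x) x)
    (hf₁ : ∀ x ∈ Set.Icc (0 : ℝ) 1, HasDerivAt f₁ (f₂ x) x)
    (hf₂ : ∀ x ∈ Set.Icc (0 : ℝ) 1, HasDerivAt f₂ (f₃ x) x)
    (hf₃ : ContinuousOn f₃ (Set.Icc 0 1)) :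
    (f 0 + f 1) / 2 - (P 1 - P 0) - (f₁ 1 - f₁ 0) / 12 = emInt 3 f₃ := by
  have c0 : ContinuousOn f (Set.Icc 0 1) := fun x hx => (hf x hx).continuousAt.continuousWithinAt
  have c1 : ContinuousOn f₁ (Set.Icc 0 1) := fun x hx => (hf₁ x hx).continuousAt.continuousWithinAt
  have c2 : ContinuousOn f₂ (Set.Icc 0 1) := fun x hx => (hf₂ x hx).continuousAt.continuousWithinAt
  have e0 := emInt_eq_sub_emInt_succ 0 hf c1
  have e1 := emInt_eq_sub_emInt_succ 1 hf₁ c2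
  have e2 := emInt_eq_sub_emInt_succ 2 hf₂ hf₃
  -- This kills the boundary term in `f₂`, so no second derivative appears in the formula.
  have b3 : bernoulli 3 = 0 := bernoulli_eq_zero_of_odd (by decide) (by norm_num)
  rw [emInt_zero hP c0] at e0
  norm_num [bernoulliFun_eval_one, bernoulliFun_eval_zero, Nat.factorial, b3] at e0 e1 e2
  linear_combination -e0 + e1 - e2

end Barnes
end

/-! ### The Glaisher–Kinkelin constant -/

noncomputable section
namespace Barnes

/-- The functional equation is differentiated at `s = 2`, where `cos (π s / 2)` has derivative `0`,
`Γ'(2) = 1 - γ` and `ζ(2) = π² / 6`. In other words, `log A = 1/12 - ζ'(-1)`. -/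
theorem deriv_riemannZeta_neg_one :
    deriv riemannZeta (-1) = 1 / 12 - (((Real.eulerMascheroniConstant : ℂ) +
      Real.log (2 * Real.pi)) / 12 - deriv riemannZeta 2 / (2 * Real.pi ^ 2)) := by
  have hpi : (Real.pi : ℂ) ≠ 0 := by exact_mod_cast Real.pi_ne_zero
  have h2pi : (2 * (Real.pi : ℂ)) ≠ 0 := mul_ne_zero two_ne_zero hpi
  have hz : HasDerivAt riemannZeta (deriv riemannZeta (-1)) (1 - 2) := by
    rw [show (1 - 2 : ℂ) = -1 by norm_num]
    exact (differentiableAt_riemannZeta (by norm_num)).hasDerivAt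
  have hl := hz.comp_const_sub (1 : ℂ) 2
  have hz2 : HasDerivAt riemannZeta (deriv riemannZeta 2) 2 :=
    (differentiableAt_riemannZeta (by norm_num)).hasDerivAt
  have hG := Complex.hasDerivAt_Gamma_nat 1
  have e2 : ((1 : ℕ) : ℂ) + 1 = 2 := by norm_num
  rw [e2] at hG
  have hp := (hasDerivAt_neg (2 : ℂ)).const_cpow (c := 2 * (Real.pi : ℂ)) (Or.inl h2pi)
  have hc := (((hasDerivAt_id (2 : ℂ)).const_mul (Real.pi : ℂ)).div_const 2).ccos
  have hr := (((hp.const_mul 2).mul hG).mul hc).mul hz2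
  have heq : (fun s : ℂ => riemannZeta (1 - s)) =ᶠ[𝓝 2] fun s =>
      2 * (2 * (Real.pi : ℂ)) ^ (-s) * Complex.Gamma s * Complex.cos (Real.pi * s / 2) *
        riemannZeta s := by
    have : {s : ℂ | 1 < s.re} ∈ 𝓝 (2 : ℂ) :=
      (isOpen_lt continuous_const Complex.continuous_re).mem_nhds (by simp)
    filter_upwards [this] with s hs
    refine riemannZeta_one_sub (fun n h => ?_) (fun h => ?_)
    · rw [h] at hs
      have : (0 : ℝ) ≤ n := n.cast_nonneg
      simp at hs
      linarith
    · rw [h] at hs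
      simp at hs
  have hu := (hl.congr_of_eventuallyEq heq.symm).unique hr
  have hG2 : Complex.Gamma 2 = 1 := by
    have := Complex.Gamma_nat_eq_factorial 1
    rwa [e2, Nat.factorial_one, Nat.cast_one] at this
  have hlog : Complex.log (2 * (Real.pi : ℂ)) = ((Real.log (2 * Real.pi) : ℝ) : ℂ) := by
    rw [Complex.ofReal_log (by positivity)]
    push_cast; rfl
  have hpow : (2 * (Real.pi : ℂ)) ^ (-2 : ℂ) = 1 / (4 * (Real.pi : ℂ) ^ 2) := by
    rw [Complex.cpow_neg, show (2 : ℂ) = ((2 : ℕ) : ℂ) by norm_num, Complex.cpow_natCast]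
    push_cast
    rw [mul_pow]; norm_num
  have harg : (Real.pi : ℂ) * 2 / 2 = Real.pi := by ring
  simp only [Pi.mul_apply, id_eq, harg, Complex.cos_pi, Complex.sin_pi, hG2, hlog, hpow,
    riemannZeta_two, Nat.factorial_one, harmonic, Finset.sum_range_one, Nat.cast_one,
    zero_add, inv_one, Rat.cast_one, neg_zero, zero_mul, mul_zero, add_zero] at hu
  rw [neg_eq_iff_eq_neg] at hu
  rw [hu]
  field_simp
  ring

/-- The Euler--Maclaurin remainders of `∑ k^{-s}`. -/
def zetaTerm (k : ℕ) (s : ℂ) : ℂ :=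
  (((k : ℂ) + 1) ^ (-s) + ((k : ℂ) + 2) ^ (-s)) / 2 -
    (((k : ℂ) + 2) ^ (1 - s) - ((k : ℂ) + 1) ^ (1 - s)) / (1 - s) +
    s / 12 * (((k : ℂ) + 2) ^ (-s - 1) - ((k : ℂ) + 1) ^ (-s - 1))

theorem hasDerivAt_add_ofReal_cpow (k : ℕ) (c : ℂ) {t : ℝ} (ht : 0 ≤ t) :
    HasDerivAt (fun t : ℝ => ((k : ℂ) + 1 + t) ^ c) (c * ((k : ℂ) + 1 + t) ^ (c - 1)) t := by
  have hs : (k : ℂ) + 1 + (t : ℂ) ∈ Complex.slitPlane := by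
    have h0 : 0 < (k : ℝ) + 1 + t := by positivity
    exact_mod_cast Complex.ofReal_mem_slitPlane.2 h0
  have h := (((hasDerivAt_id (t : ℂ)).const_add ((k : ℂ) + 1)).cpow_const (c := c) hs).comp_ofReal
  simpa using h

theorem zetaTerm_eq_emInt (k : ℕ) {s : ℂ} (hs : s ≠ 1) :
    zetaTerm k s = emInt 3 fun t => -s * ((-s - 1) * ((-s - 1 - 1) *
      ((k : ℂ) + 1 + t) ^ (-s - 1 - 1 - 1))) := by
  have h1s : (1 - s) ≠ 0 := sub_ne_zero.2 hs.symm
  have h := eulerMaclaurin_third_order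
    (P := fun t : ℝ => ((k : ℂ) + 1 + t) ^ (1 - s) / (1 - s))
    (f := fun t : ℝ => ((k : ℂ) + 1 + t) ^ (-s))
    (f₁ := fun t : ℝ => -s * ((k : ℂ) + 1 + t) ^ (-s - 1))
    (f₂ := fun t : ℝ => -s * ((-s - 1) * ((k : ℂ) + 1 + t) ^ (-s - 1 - 1)))
    (f₃ := fun t : ℝ => -s * ((-s - 1) * ((-s - 1 - 1) * ((k : ℂ) + 1 + t) ^ (-s - 1 - 1 - 1))))
    (fun t ht => by
      have := (hasDerivAt_add_ofReal_cpow k (1 - s) ht.1).div_const (1 - s)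
      convert! this using 1
      rw [mul_div_cancel_left₀ _ h1s]
      congr 1; ring)
    (fun t ht => hasDerivAt_add_ofReal_cpow k _ ht.1)
    (fun t ht => (hasDerivAt_add_ofReal_cpow k _ ht.1).const_mul _)
    (fun t ht => ((hasDerivAt_add_ofReal_cpow k _ ht.1).const_mul _).const_mul _)
    (fun t ht => (((((hasDerivAt_add_ofReal_cpow k (-s - 1 - 1 - 1) ht.1).const_mul
      (-s - 1 - 1)).const_mul (-s - 1)).const_mul (-s)).continuousAt).continuousWithinAt)
  rw [← h, zetaTerm]
  simp only [Complex.ofReal_zero, Complex.ofReal_one, add_zero, add_assoc, one_add_one_eq_two]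
  ring

/-- A punctured neighbourhood of `[-1, 2]` on which the terms are uniformly small. -/
def zetaDomain : Set ℂ := ({s : ℂ | -3 / 2 < s.re} ∩ Metric.ball 0 4) ∩ {1}ᶜ

theorem isOpen_zetaDomain : IsOpen zetaDomain :=
  ((isOpen_lt continuous_const Complex.continuous_re).inter Metric.isOpen_ball).inter
    isOpen_compl_singleton

/-- Removing `1` from a convex set leaves the union of its four convex pieces above, below, left and
right of `1`; these are joined successively through common points. -/
theorem isPreconnected_zetaDomain : IsPreconnected zetaDomain := by
  have hc : Convex ℝ ({s : ℂ | -3 / 2 < s.re} ∩ Metric.ball 0 4) :=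
    (convex_halfSpace_re_gt _).inter (convex_ball _ _)
  set S := {s : ℂ | -3 / 2 < s.re} ∩ Metric.ball (0 : ℂ) 4 with hS
  have hmem : ∀ x y : ℝ, -3 / 2 < x → |x| + |y| < 4 → (⟨x, y⟩ : ℂ) ∈ S := fun x y hx hxy =>
    ⟨hx, by
      rw [mem_ball_zero_iff]
      exact (Complex.norm_le_abs_re_add_abs_im _).trans_lt hxy⟩
  have hU : IsPreconnected (S ∩ {s : ℂ | 0 < s.im}) :=
    (hc.inter (convex_halfSpace_im_gt _)).isPreconnected
  have hD : IsPreconnected (S ∩ {s : ℂ | s.im < 0}) :=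
    (hc.inter (convex_halfSpace_im_lt _)).isPreconnected
  have hL : IsPreconnected (S ∩ {s : ℂ | s.re < 1}) :=
    (hc.inter (convex_halfSpace_re_lt _)).isPreconnected
  have hR : IsPreconnected (S ∩ {s : ℂ | 1 < s.re}) :=
    (hc.inter (convex_halfSpace_re_gt _)).isPreconnected
  have m1 : (⟨0, 1⟩ : ℂ) ∈ S := hmem _ _ (by norm_num) (by norm_num)
  have m2 : (⟨2, 1⟩ : ℂ) ∈ S := hmem _ _ (by norm_num) (by norm_num)
  have m3 : (⟨0, -1⟩ : ℂ) ∈ S := hmem _ _ (by norm_num) (by norm_num)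
  have h1 := IsPreconnected.union' (by exact ⟨⟨0, 1⟩, ⟨m1, by simp⟩, ⟨m1, by simp⟩⟩) hU hL
  have h2 := IsPreconnected.union' (by exact ⟨⟨2, 1⟩, Or.inl ⟨m2, by simp⟩, ⟨m2, by simp⟩⟩) h1 hR
  have h := IsPreconnected.union' (by exact ⟨⟨0, -1⟩, Or.inl (Or.inr ⟨m3, by simp⟩), ⟨m3, by simp⟩⟩) h2 hD
  convert! h using 1
  rw [zetaDomain, ← hS, ← Set.inter_union_distrib_left, ← Set.inter_union_distrib_left,
    ← Set.inter_union_distrib_left]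
  congr 1
  ext s
  simp only [Set.mem_compl_iff, Set.mem_singleton_iff, Set.mem_union, Set.mem_ofPred_eq,
    Complex.ext_iff, Complex.one_re, Complex.one_im]
  grind

/-- The third derivative of `x ^ (-s)` has order `x ^ (-Re s - 3)`, and `Re s > -3/2` makes this
exponent less than `-3/2`. The factors `4`, `5`, `6` bound `s`, `s + 1`, `s + 2` on the ball of
radius `4`. -/
theorem exists_norm_zetaTerm_le : ∃ M : ℝ, ∀ k : ℕ, ∀ s ∈ zetaDomain,
    ‖zetaTerm k s‖ ≤ M * ((k + 1 : ℕ) : ℝ) ^ (-(3 / 2) : ℝ) := by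
  obtain ⟨M, hM, h⟩ := exists_norm_emInt_le 3
  refine ⟨M * (4 * (5 * 6)), fun k s hs => ?_⟩
  obtain ⟨⟨hs1, hs2⟩, hs3⟩ := hs
  rw [zetaTerm_eq_emInt k hs3, mul_assoc]
  have hn : ‖s‖ < 4 := by simpa using hs2
  have hre : -3 / 2 < s.re := hs1
  have hn1 : ‖-s - 1‖ ≤ 5 := (norm_sub_le _ _).trans (by rw [norm_neg, norm_one]; linarith)
  have hn2 : ‖-s - 1 - 1‖ ≤ 6 := (norm_sub_le _ _).trans (by rw [norm_one]; linarith)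
  refine h _ _ fun t ht => ?_
  have hx : (1 : ℝ) ≤ k + 1 := by linarith [(Nat.cast_nonneg k : (0 : ℝ) ≤ k)]
  have hx0 : (0 : ℝ) < k + 1 + t := by linarith [ht.1]
  have hpow : ‖((k : ℂ) + 1 + t) ^ (-s - 1 - 1 - 1)‖ ≤ ((k + 1 : ℕ) : ℝ) ^ (-(3 / 2) : ℝ) := by
    have e : (k : ℂ) + 1 + t = ((k + 1 + t : ℝ) : ℂ) := by push_cast; rfl
    rw [e, Complex.norm_cpow_eq_rpow_re_of_pos hx0]
    push_cast
    calc ((k : ℝ) + 1 + t) ^ (-s - 1 - 1 - 1).re ≤ ((k : ℝ) + 1 + t) ^ (-(3 / 2) : ℝ) := by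
          refine Real.rpow_le_rpow_of_exponent_le (by linarith [ht.1]) ?_
          simp only [Complex.sub_re, Complex.neg_re, Complex.one_re]
          linarith
      _ ≤ _ := Real.rpow_le_rpow_of_nonpos (by linarith) (by linarith [ht.1]) (by norm_num)
  rw [norm_mul, norm_mul, norm_mul, norm_neg]
  calc _ ≤ 4 * (5 * (6 * ((k + 1 : ℕ) : ℝ) ^ (-(3 / 2) : ℝ))) := by gcongr
    _ = _ := by ring

theorem summable_zetaBound (M : ℝ) :
    Summable fun k : ℕ => M * ((k + 1 : ℕ) : ℝ) ^ (-(3 / 2) : ℝ) :=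
  ((summable_nat_add_iff 1).2 (Real.summable_nat_rpow.2 (by norm_num))).mul_left M

theorem differentiableOn_zetaTerm (k : ℕ) : DifferentiableOn ℂ (zetaTerm k) zetaDomain := by
  intro s hs
  have h1s : (1 - s) ≠ 0 := sub_ne_zero.2 (Ne.symm hs.2)
  have h1 : (k : ℂ) + 1 ≠ 0 := by exact_mod_cast k.succ_ne_zero
  have h2 : (k : ℂ) + 2 ≠ 0 := by exact_mod_cast (k + 1).succ_ne_zero
  unfold zetaTerm
  refine DifferentiableAt.differentiableWithinAt ?_
  have d1 : ∀ c : ℂ, c ≠ 0 → DifferentiableAt ℂ (fun s : ℂ => c ^ (-s)) s := fun c hc =>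
    DifferentiableAt.const_cpow (by fun_prop) (Or.inl hc)
  have d2 : ∀ c : ℂ, c ≠ 0 → DifferentiableAt ℂ (fun s : ℂ => c ^ (1 - s)) s := fun c hc =>
    DifferentiableAt.const_cpow (by fun_prop) (Or.inl hc)
  have d3 : ∀ c : ℂ, c ≠ 0 → DifferentiableAt ℂ (fun s : ℂ => c ^ (-s - 1)) s := fun c hc =>
    DifferentiableAt.const_cpow (by fun_prop) (Or.inl hc)
  exact ((((d1 _ h1).add (d1 _ h2)).div_const 2).sub
    (((d2 _ h2).sub (d2 _ h1)).div (by fun_prop) h1s)).add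
    ((differentiableAt_id.div_const 12).mul ((d3 _ h2).sub (d3 _ h1)))

theorem sum_zetaTerm (N : ℕ) {s : ℂ} :
    ∑ k ∈ Finset.range N, zetaTerm k s = ∑ k ∈ Finset.range N, ((k : ℂ) + 1) ^ (-s) +
      (((N : ℂ) + 1) ^ (-s) - 1) / 2 - (((N : ℂ) + 1) ^ (1 - s) - 1) / (1 - s) +
      s / 12 * (((N : ℂ) + 1) ^ (-s - 1) - 1) := by
  induction N with
  | zero => simp
  | succ N ih =>
    rw [Finset.sum_range_succ, Finset.sum_range_succ, ih, zetaTerm]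
    push_cast
    rw [show (N : ℂ) + 1 + 1 = N + 2 by ring]
    ring

theorem tendsto_add_one_cpow {c : ℂ} (hc : c.re < 0) :
    Tendsto (fun N : ℕ => ((N : ℂ) + 1) ^ c) atTop (𝓝 0) := by
  rw [tendsto_zero_iff_norm_tendsto_zero]
  have h := (tendsto_rpow_neg_atTop (y := -c.re) (by linarith)).comp
    (tendsto_natCast_atTop_atTop.comp (tendsto_add_atTop_nat 1))
  refine h.congr fun N => ?_
  have e : (N : ℂ) + 1 = ((N + 1 : ℝ) : ℂ) := by push_cast; rfl
  rw [e, Complex.norm_cpow_eq_rpow_re_of_pos (by positivity)]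
  simp

theorem tsum_zetaTerm_of_one_lt_re {s : ℂ} (hs : s ∈ zetaDomain) (h1 : 1 < s.re) :
    ∑' k, zetaTerm k s = riemannZeta s - 1 / 2 + 1 / (1 - s) - s / 12 := by
  obtain ⟨M, hM⟩ := exists_norm_zetaTerm_le
  have hsum : Summable fun k => zetaTerm k s :=
    Summable.of_norm_bounded (summable_zetaBound M) fun k => hM k s hs
  refine tendsto_nhds_unique hsum.hasSum.tendsto_sum_nat ?_
  simp_rw [sum_zetaTerm]
  have hz : Summable fun k : ℕ => ((k : ℂ) + 1) ^ (-s) := by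
    have := (summable_nat_add_iff 1).2 (Complex.summable_one_div_nat_cpow.2 h1)
    refine this.congr fun k => ?_
    rw [Complex.cpow_neg, one_div]; push_cast; rfl
  have hz' := hz.hasSum.tendsto_sum_nat
  have e : ∑' k : ℕ, ((k : ℂ) + 1) ^ (-s) = riemannZeta s := by
    rw [zeta_eq_tsum_one_div_nat_add_one_cpow h1]
    exact tsum_congr fun k => by rw [Complex.cpow_neg, one_div]
  rw [e] at hz'
  have t1 := tendsto_add_one_cpow (c := -s) (by simp; linarith)
  have t2 := tendsto_add_one_cpow (c := 1 - s) (by simp; linarith)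
  have t3 := tendsto_add_one_cpow (c := -s - 1) (by simp; linarith)
  convert! ((hz'.add ((t1.sub_const 1).div_const 2)).sub ((t2.sub_const 1).div_const (1 - s))).add
    ((t3.sub_const 1).const_mul (s / 12)) using 2
  ring

/-- Identity theorem: both sides are analytic on the connected domain and agree near `2`. -/
theorem tsum_zetaTerm {s : ℂ} (hs : s ∈ zetaDomain) :
    ∑' k, zetaTerm k s = riemannZeta s - 1 / 2 + 1 / (1 - s) - s / 12 := by
  obtain ⟨M, hM⟩ := exists_norm_zetaTerm_le
  have hd1 : DifferentiableOn ℂ (fun s => ∑' k, zetaTerm k s) zetaDomain :=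
    Complex.differentiableOn_tsum_of_summable_norm (summable_zetaBound M)
      differentiableOn_zetaTerm isOpen_zetaDomain fun k s hs => hM k s hs
  have hd2 : DifferentiableOn ℂ (fun s => riemannZeta s - 1 / 2 + 1 / (1 - s) - s / 12)
      zetaDomain := by
    intro s hs
    have h1s : (1 - s) ≠ 0 := sub_ne_zero.2 (Ne.symm hs.2)
    have hz := differentiableAt_riemannZeta hs.2
    refine DifferentiableAt.differentiableWithinAt ?_
    fun_prop (disch := assumption)
  have h2 : (2 : ℂ) ∈ zetaDomain := by
    refine ⟨⟨?_, ?_⟩, ?_⟩ <;> norm_num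
  refine (hd1.analyticOnNhd isOpen_zetaDomain).eqOn_of_preconnected_of_eventuallyEq
    (hd2.analyticOnNhd isOpen_zetaDomain) isPreconnected_zetaDomain h2 ?_ hs
  have : {s : ℂ | 1 < s.re} ∈ 𝓝 (2 : ℂ) :=
    (isOpen_lt continuous_const Complex.continuous_re).mem_nhds (by simp)
  filter_upwards [this, isOpen_zetaDomain.mem_nhds h2] with s h h'
  exact tsum_zetaTerm_of_one_lt_re h' h

theorem neg_one_mem_zetaDomain : (-1 : ℂ) ∈ zetaDomain := by
  refine ⟨⟨?_, ?_⟩, ?_⟩ <;> norm_num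

theorem deriv_zetaTerm_neg_one (k : ℕ) :
    deriv (zetaTerm k) (-1) =
      -(((k : ℂ) + 1) * Complex.log (k + 1) + ((k : ℂ) + 2) * Complex.log (k + 2)) / 2 +
      (((k : ℂ) + 2) ^ 2 * Complex.log (k + 2) - ((k : ℂ) + 1) ^ 2 * Complex.log (k + 1)) / 2 -
      (((k : ℂ) + 2) ^ 2 - ((k : ℂ) + 1) ^ 2) / 4 +
      (Complex.log (k + 2) - Complex.log (k + 1)) / 12 := by
  have h1 : (k : ℂ) + 1 ≠ 0 := by exact_mod_cast k.succ_ne_zero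
  have h2 : (k : ℂ) + 2 ≠ 0 := by exact_mod_cast (k + 1).succ_ne_zero
  have d1 : ∀ c : ℂ, c ≠ 0 → HasDerivAt (fun s : ℂ => c ^ (-s)) (-(c * Complex.log c)) (-1) := by
    intro c hc
    convert! (hasDerivAt_neg (-1 : ℂ)).const_cpow (c := c) (Or.inl hc) using 1
    simp
  have d2 : ∀ c : ℂ, c ≠ 0 →
      HasDerivAt (fun s : ℂ => c ^ (1 - s)) (-(c ^ 2 * Complex.log c)) (-1) := by
    intro c hc
    convert! ((hasDerivAt_id (-1 : ℂ)).const_sub 1).const_cpow (c := c) (Or.inl hc) using 1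
    norm_num
  have d3 : ∀ c : ℂ, c ≠ 0 →
      HasDerivAt (fun s : ℂ => c ^ (-s - 1)) (-(Complex.log c)) (-1) := by
    intro c hc
    convert! ((hasDerivAt_neg (-1 : ℂ)).sub_const 1).const_cpow (c := c) (Or.inl hc) using 1
    norm_num
  have hd := ((((d1 _ h1).add (d1 _ h2)).div_const 2).sub
    (((d2 _ h2).sub (d2 _ h1)).div ((hasDerivAt_id (-1 : ℂ)).const_sub 1) (by norm_num))).add
    (((hasDerivAt_id (-1 : ℂ)).div_const 12).mul ((d3 _ h2).sub (d3 _ h1)))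
  have he := hd.deriv
  refine Eq.trans ?_ (he.trans ?_)
  · rfl
  · have e2 : ∀ c : ℂ, c ^ (1 - -1 : ℂ) = c ^ 2 := fun c => by norm_num
    have e0 : ∀ c : ℂ, c ^ (- -1 - 1 : ℂ) = 1 := fun c => by norm_num
    simp only [id_eq, e2, e0, Pi.sub_apply]
    ring

theorem sum_deriv_zetaTerm (N : ℕ) :
    ∑ k ∈ Finset.range N, deriv (zetaTerm k) (-1) =
      -∑ k ∈ Finset.range (N + 1), ((k : ℂ) + 1) * Complex.log (k + 1) +
      ((N : ℂ) + 1) * Complex.log (N + 1) / 2 + ((N : ℂ) + 1) ^ 2 * Complex.log (N + 1) / 2 -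
      (((N : ℂ) + 1) ^ 2 - 1) / 4 + Complex.log (N + 1) / 12 := by
  induction N with
  | zero => simp
  | succ N ih =>
    rw [Finset.sum_range_succ, Finset.sum_range_succ _ (N + 1), ih, deriv_zetaTerm_neg_one]
    push_cast
    rw [show (N : ℂ) + 1 + 1 = N + 2 by ring]
    ring

/-- The asymptotic formula for the hyperfactorial that characterizes the constant `A`. -/
theorem tendsto_sum_mul_log_glaisher :
    Tendsto (fun n : ℕ => ∑ k ∈ Finset.range n, ((k : ℝ) + 1) * Real.log (k + 1) -
      ((n : ℝ) ^ 2 / 2 + n / 2 + 1 / 12) * Real.log n + (n : ℝ) ^ 2 / 4) atTop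
      (𝓝 (Real.log glaisher)) := by
  obtain ⟨M, hM⟩ := exists_norm_zetaTerm_le
  have hs := (Complex.hasSum_deriv_of_summable_norm (summable_zetaBound M)
    differentiableOn_zetaTerm isOpen_zetaDomain (fun k s hs => hM k s hs)
    neg_one_mem_zetaDomain).tendsto_sum_nat
  have hd : deriv (fun s => ∑' k, zetaTerm k s) (-1) =
      deriv riemannZeta (-1) + 1 / 4 - 1 / 12 := by
    have heq : (fun s => ∑' k, zetaTerm k s) =ᶠ[𝓝 (-1)]
        fun s => riemannZeta s - 1 / 2 + 1 / (1 - s) - s / 12 := by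
      filter_upwards [isOpen_zetaDomain.mem_nhds neg_one_mem_zetaDomain] with s hs
      exact tsum_zetaTerm hs
    rw [heq.deriv_eq]
    have hz := (differentiableAt_riemannZeta (s := -1) (by norm_num)).hasDerivAt
    have hi := (hasDerivAt_const (-1 : ℂ) (1 : ℂ)).div
      ((hasDerivAt_id (-1 : ℂ)).const_sub 1) (by norm_num)
    have h := ((hz.sub_const (1 / 2)).add hi).sub ((hasDerivAt_id (-1 : ℂ)).div_const 12)
    refine Eq.trans ?_ (h.deriv.trans ?_)
    · rfl
    · norm_num
  rw [hd, deriv_riemannZeta_neg_one] at hs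
  simp_rw [sum_deriv_zetaTerm] at hs
  rw [← tendsto_add_atTop_iff_nat 1]
  -- The `1 / 4` absorbs the constant in `((N + 1) ^ 2 - 1) / 4`; the limit becomes `1/12 - ζ'(-1)`.
  have hre := (Complex.continuous_re.tendsto _).comp (hs.const_sub (1 / 4))
  have hlog : ∀ k : ℕ, Complex.log ((k : ℂ) + 1) = ((Real.log (k + 1) : ℝ) : ℂ) := fun k => by
    rw [Complex.ofReal_log (by positivity)]; push_cast; rfl
  have hval : (1 / 4 - (1 / 12 - (((Real.eulerMascheroniConstant : ℂ) +
      Real.log (2 * Real.pi)) / 12 - deriv riemannZeta 2 / (2 * Real.pi ^ 2)) + 1 / 4 - 1 / 12)).re =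
      Real.log glaisher := by
    rw [glaisher, Real.log_exp]
    have e : (1 / 4 - (1 / 12 - (((Real.eulerMascheroniConstant : ℂ) +
      Real.log (2 * Real.pi)) / 12 - deriv riemannZeta 2 / (2 * Real.pi ^ 2)) + 1 / 4 - 1 / 12)) =
      ((((Real.eulerMascheroniConstant : ℝ) + Real.log (2 * Real.pi)) / 12 : ℝ) : ℂ) -
        deriv riemannZeta 2 / ((2 * Real.pi ^ 2 : ℝ) : ℂ) := by push_cast; ring
    rw [e, Complex.sub_re, Complex.ofReal_re, Complex.div_ofReal_re]
  rw [hval] at hre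
  refine hre.congr fun n => ?_
  simp only [Function.comp_apply, hlog]
  rw [← Complex.ofReal_re (∑ k ∈ Finset.range (n + 1), _ - _ + _)]
  congr 1
  push_cast
  ring

end Barnes
end

/-! ### The exact formula for `G (z + 1)` -/

noncomputable section
namespace Barnes

/-- The `q`-th derivative of `z ↦ 1 / z`. -/
def invDeriv (q : ℕ) (z : ℂ) : ℂ := (-1) ^ q * q.factorial / z ^ (q + 1)

theorem hasDerivAt_invDeriv (q : ℕ) {z : ℂ} (hz : z ≠ 0) :
    HasDerivAt (invDeriv q) (invDeriv (q + 1) z) z := by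
  have h := ((hasDerivAt_pow (q + 1) z).inv (pow_ne_zero _ hz)).const_mul ((-1) ^ q * (q.factorial : ℂ))
  convert! h using 1
  rw [invDeriv, Nat.factorial_succ, Nat.add_sub_cancel]
  push_cast
  field_simp
  ring

/-- The Euler--Maclaurin remainder of order `q + 3` of `z log z` on `[z, z + 1]`. -/
def logTerm (q : ℕ) (z : ℂ) : ℂ := emInt (q + 3) fun x => invDeriv (q + 1) (z + x)

/-- The Euler--Maclaurin remainder of order `q + 3` of `∑ (z + n) log (z + n)`. -/
def logRemainder (q : ℕ) (z : ℂ) : ℂ := ∑' n : ℕ, logTerm q (z + n)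

theorem add_ofReal_mem_slitPlane {z : ℂ} (hz : z ∈ Complex.slitPlane) {x : ℝ} (hx : 0 ≤ x) :
    z + x ∈ Complex.slitPlane := by
  rw [Complex.mem_slitPlane_iff] at hz ⊢
  simp only [Complex.add_re, Complex.ofReal_re, Complex.add_im, Complex.ofReal_im, add_zero]
  rcases hz with h | h
  · exact Or.inl (by linarith)
  · exact Or.inr h

theorem add_natCast_mem_slitPlane {z : ℂ} (hz : z ∈ Complex.slitPlane) (n : ℕ) :
    z + n ∈ Complex.slitPlane := by
  simpa using add_ofReal_mem_slitPlane hz (x := n) n.cast_nonneg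

theorem hasDerivAt_comp_add_ofReal {f : ℂ → ℂ} {f' z : ℂ} {x : ℝ}
    (h : HasDerivAt f f' (z + x)) : HasDerivAt (fun x : ℝ => f (z + x)) f' x :=
  (HasDerivAt.comp_const_add z (x : ℂ) h).comp_ofReal

/-- The antidifference of `z log z` up to the remainder `logTerm 0`. -/
def mulLogAntidiff (z : ℂ) : ℂ :=
  z * Complex.log z / 2 + (z ^ 2 / 2 * Complex.log z - z ^ 2 / 4) + Complex.log z / 12

/-- Euler–Maclaurin for `w log w` on `[z, z + 1]`; adding half the increment turns the trapezoidal
mean into the right endpoint value. -/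
theorem mul_log_add_one {z : ℂ} (hz : z ∈ Complex.slitPlane) :
    (z + 1) * Complex.log (z + 1) = mulLogAntidiff (z + 1) - mulLogAntidiff z + logTerm 0 z := by
  have hs : ∀ x ∈ Set.Icc (0 : ℝ) 1, z + x ∈ Complex.slitPlane := fun x hx =>
    add_ofReal_mem_slitPlane hz hx.1
  have h := eulerMaclaurin_third_order
    (P := fun x : ℝ => (fun w : ℂ => w ^ 2 / 2 * Complex.log w - w ^ 2 / 4) (z + x))
    (f := fun x : ℝ => (fun w : ℂ => w * Complex.log w) (z + x))
    (f₁ := fun x : ℝ => (fun w : ℂ => Complex.log w + 1) (z + x))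
    (f₂ := fun x : ℝ => invDeriv 0 (z + x))
    (f₃ := fun x : ℝ => invDeriv 1 (z + x))
    (fun x hx => by
      have h0 := Complex.slitPlane_ne_zero (hs x hx)
      refine hasDerivAt_comp_add_ofReal (f := fun w : ℂ => w ^ 2 / 2 * Complex.log w - w ^ 2 / 4) ?_
      have := (((hasDerivAt_pow 2 (z + x : ℂ)).div_const 2).mul
        (Complex.hasDerivAt_log (hs x hx))).sub ((hasDerivAt_pow 2 (z + x : ℂ)).div_const 4)
      convert! this using 1
      field_simp
      ring)
    (fun x hx => by
      have h0 := Complex.slitPlane_ne_zero (hs x hx)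
      refine hasDerivAt_comp_add_ofReal (f := fun w : ℂ => w * Complex.log w) ?_
      have := (hasDerivAt_id (z + x : ℂ)).mul (Complex.hasDerivAt_log (hs x hx))
      convert! this using 1
      simp [h0])
    (fun x hx => by
      refine hasDerivAt_comp_add_ofReal (f := fun w : ℂ => Complex.log w + 1) ?_
      have := (Complex.hasDerivAt_log (hs x hx)).add_const 1
      convert! this using 1
      simp [invDeriv])
    (fun x hx => hasDerivAt_comp_add_ofReal
      (hasDerivAt_invDeriv 0 (Complex.slitPlane_ne_zero (hs x hx))))
    (fun x hx => (hasDerivAt_comp_add_ofReal (hasDerivAt_invDeriv 1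
      (Complex.slitPlane_ne_zero (hs x hx)))).continuousAt.continuousWithinAt)
  have h' : logTerm 0 z = emInt 3 fun x => invDeriv 1 (z + x) := rfl
  rw [h', ← h]
  simp only [Complex.ofReal_zero, Complex.ofReal_one, add_zero, mulLogAntidiff]
  ring

theorem log_one_add_div {z : ℂ} (hz : z ∈ Complex.slitPlane) {k : ℕ} (hk : k ≠ 0) :
    Complex.log (1 + z / k) = Complex.log (z + k) - (Real.log k : ℝ) := by
  have hk0 : (k : ℂ) ≠ 0 := by exact_mod_cast hk
  have hs := Complex.slitPlane_ne_zero (add_natCast_mem_slitPlane hz k)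
  have hk' : (0 : ℝ) < k := by exact_mod_cast Nat.pos_of_ne_zero hk
  have e : z + k = ((k : ℝ) : ℂ) * (1 + z / k) := by
    push_cast; field_simp; ring
  have h1 : 1 + z / k ≠ 0 := fun h => hs (by rw [e, h, mul_zero])
  rw [e, Complex.log_ofReal_mul hk' h1]
  ring

theorem norm_log_one_add_sub_sub_le {u : ℂ} (hu : ‖u‖ ≤ 1 / 2) :
    ‖Complex.log (1 + u) - u + u ^ 2 / 2‖ ≤ ‖u‖ ^ 3 := by
  have h := Complex.norm_log_sub_logTaylor_le 2 (z := u) (by linarith)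
  have e : Complex.logTaylor (2 + 1) u = u - u ^ 2 / 2 := by
    simp [Complex.logTaylor_succ, Complex.logTaylor_zero]
    ring
  rw [e] at h
  rw [show Complex.log (1 + u) - u + u ^ 2 / 2 = Complex.log (1 + u) - (u - u ^ 2 / 2) by ring]
  refine h.trans ?_
  have h2 : (1 - ‖u‖)⁻¹ ≤ 2 := by
    rw [inv_le_comm₀ (by linarith) two_pos]; linarith
  have h3 : 0 ≤ ‖u‖ ^ 3 := by positivity
  push_cast
  rw [div_le_iff₀ (by norm_num)]
  norm_num
  nlinarith

theorem norm_natCast_mul_log_le (z : ℂ) {k : ℕ} (hk : 2 * ‖z‖ ≤ k) (hk0 : k ≠ 0) :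
    ‖(k : ℂ) * Complex.log (1 + z / k) - z + z ^ 2 / (2 * k)‖ ≤ ‖z‖ ^ 3 / (k : ℝ) ^ 2 := by
  have hk' : (0 : ℝ) < k := by exact_mod_cast Nat.pos_of_ne_zero hk0
  have hkc : (k : ℂ) ≠ 0 := by exact_mod_cast hk0
  have hn : ‖z / k‖ = ‖z‖ / k := by rw [norm_div, Complex.norm_natCast]
  have h := norm_log_one_add_sub_sub_le (u := z / k) (by
    rw [hn, div_le_iff₀ hk']; linarith)
  have e : (k : ℂ) * Complex.log (1 + z / k) - z + z ^ 2 / (2 * k) =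
      k * (Complex.log (1 + z / k) - z / k + (z / k) ^ 2 / 2) := by
    field_simp
  rw [e, norm_mul, Complex.norm_natCast]
  calc (k : ℝ) * _ ≤ k * ‖z / k‖ ^ 3 := by gcongr
    _ = _ := by rw [hn]; field_simp

theorem summable_log_G_factor (z : ℂ) : Summable fun k : ℕ =>
    ((k : ℂ) + 1) * Complex.log (1 + z / ((k : ℂ) + 1)) - z + z ^ 2 / (2 * ((k : ℂ) + 1)) := by
  have hs : Summable fun k : ℕ => ‖z‖ ^ 3 / ((k + 1 : ℕ) : ℝ) ^ 2 := by
    simp only [div_eq_mul_inv]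
    refine Summable.mul_left _ ?_
    exact (summable_nat_add_iff 1).2 (Real.summable_nat_pow_inv.2 one_lt_two)
  refine Summable.of_norm_bounded_eventually_nat hs ?_
  obtain ⟨K, hK⟩ := exists_nat_ge (2 * ‖z‖)
  filter_upwards [eventually_ge_atTop K] with k hk
  have hk' : (K : ℝ) ≤ ((k + 1 : ℕ) : ℝ) := by exact_mod_cast (by omega)
  have := norm_natCast_mul_log_le z (hK.trans hk') k.succ_ne_zero
  simpa using this

theorem G_add_one_eq {z : ℂ} (hz : z ∈ Complex.slitPlane) :
    G (z + 1) = Complex.exp (z / 2 * (Real.log (2 * Real.pi) : ℝ) + (-(z * (z + 1)) / 2 -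
      (Real.eulerMascheroniConstant : ℂ) * z ^ 2 / 2) + ∑' k : ℕ,
      (((k : ℂ) + 1) * Complex.log (1 + z / ((k : ℂ) + 1)) - z + z ^ 2 / (2 * ((k : ℂ) + 1)))) := by
  have hprod := (summable_log_G_factor z).hasSum.cexp.tprod_eq
  have h2pi : (2 * (Real.pi : ℂ)) ≠ 0 :=
    mul_ne_zero two_ne_zero (by exact_mod_cast Real.pi_ne_zero)
  have hlog : Complex.log (2 * (Real.pi : ℂ)) = ((Real.log (2 * Real.pi) : ℝ) : ℂ) := by
    rw [Complex.ofReal_log (by positivity)]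
    push_cast; rfl
  rw [Complex.exp_add, Complex.exp_add, ← hprod, G, Complex.cpow_def_of_ne_zero h2pi, hlog]
  simp only [add_sub_cancel_right]
  congr 1
  · congr 2
    ring
  · refine tprod_congr fun k => ?_
    have h1 : 1 + z / ((k : ℂ) + 1) ≠ 0 := by
      have hs := Complex.slitPlane_ne_zero (add_natCast_mem_slitPlane hz (k + 1))
      have hk : (k : ℂ) + 1 ≠ 0 := by exact_mod_cast k.succ_ne_zero
      intro h
      apply hs
      field_simp at h
      push_cast
      linear_combination h
    simp only [Function.comp_apply]
    have hp : Complex.exp (((k : ℂ) + 1) * Complex.log (1 + z / ((k : ℂ) + 1))) =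
        (1 + z / ((k : ℂ) + 1)) ^ (k + 1) := by
      rw [← Nat.cast_succ, Complex.exp_nat_mul, Complex.exp_log (by simpa using h1)]
    rw [← hp, ← Complex.exp_add]
    congr 1
    ring

/-- This is where `Γ(z+1)^z` enters: subtracting `z` times the logarithm of the Gamma product
changes the weight `k` of `log (1 + z / k)` into `z + k`, and `(z + k) log (z + k)` telescopes by
`mul_log_add_one`. -/
theorem sum_log_G_factor_sub {z : ℂ} (hz : z ∈ Complex.slitPlane) (N : ℕ) :
    ∑ k ∈ Finset.range N, (((k : ℂ) + 1) * Complex.log (1 + z / ((k : ℂ) + 1)) - z +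
      z ^ 2 / (2 * ((k : ℂ) + 1))) -
    z * ∑ k ∈ Finset.range N, (z / ((k : ℂ) + 1) - Complex.log (1 + z / ((k : ℂ) + 1))) =
    mulLogAntidiff (z + N) - mulLogAntidiff z + ∑ n ∈ Finset.range N, logTerm 0 (z + n) -
      ((∑ k ∈ Finset.range N, ((k : ℝ) + 1) * Real.log (k + 1) : ℝ) : ℂ) -
      z * (Real.log N.factorial : ℝ) - N * z - z ^ 2 / 2 * (harmonic N : ℂ) := by
  induction N with
  | zero => simp
  | succ N ih =>
    have hl := log_one_add_div hz (k := N + 1) N.succ_ne_zero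
    have hm := mul_log_add_one (add_natCast_mem_slitPlane hz N)
    have hN : (N : ℂ) + 1 ≠ 0 := by exact_mod_cast N.succ_ne_zero
    have hf : Real.log (N + 1).factorial = Real.log (N + 1) + Real.log N.factorial := by
      rw [Nat.factorial_succ, Nat.cast_mul, Real.log_mul (by positivity) (by positivity)]
      push_cast; rfl
    rw [Finset.sum_range_succ, Finset.sum_range_succ, Finset.sum_range_succ,
      Finset.sum_range_succ, mul_add, harmonic_succ, hf]
    push_cast at hl ih ⊢
    rw [show z + ((N : ℂ) + 1) = z + N + 1 by ring] at hl ⊢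
    rw [hl]
    have e : z ^ 2 / (2 * ((N : ℂ) + 1)) + z ^ 2 / 2 * ((N : ℂ) + 1)⁻¹ = z * (z / ((N : ℂ) + 1)) := by
      field_simp; ring
    linear_combination ih + hm + e

theorem tendsto_log_factorial :
    Tendsto (fun n : ℕ => Real.log n.factorial - n * Real.log n + n - Real.log n / 2) atTop
      (𝓝 (Real.log (2 * Real.pi) / 2)) := by
  have h := (Stirling.tendsto_stirlingSeq_sqrt_pi.log (by positivity)).add_const (Real.log 2 / 2)
  have e : Real.log √Real.pi + Real.log 2 / 2 = Real.log (2 * Real.pi) / 2 := by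
    rw [Real.log_sqrt Real.pi_pos.le, Real.log_mul two_ne_zero Real.pi_ne_zero]; ring
  rw [e] at h
  refine h.congr' ?_
  filter_upwards [eventually_ne_atTop 0] with n hn
  have hn' : (n : ℝ) ≠ 0 := by exact_mod_cast hn
  rw [Stirling.log_stirlingSeq_formula, Real.log_mul two_ne_zero hn',
    Real.log_div hn' (Real.exp_ne_zero _), Real.log_exp]
  ring

theorem tendsto_natCast_mul_log (z : ℂ) :
    Tendsto (fun n : ℕ => (n : ℂ) * ((n : ℂ) * Complex.log (1 + z / n) - z + z ^ 2 / (2 * n)))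
      atTop (𝓝 0) := by
  refine squeeze_zero_norm' (a := fun n : ℕ => ‖z‖ ^ 3 / (n : ℝ)) ?_
    (tendsto_const_div_atTop_nhds_zero_nat _)
  obtain ⟨K, hK⟩ := exists_nat_ge (2 * ‖z‖)
  filter_upwards [eventually_ge_atTop K, eventually_ne_atTop 0] with n hn hn0
  have hk' : (K : ℝ) ≤ (n : ℝ) := by exact_mod_cast hn
  have h := norm_natCast_mul_log_le z (hK.trans hk') hn0
  have hn' : (n : ℝ) ≠ 0 := by exact_mod_cast hn0
  rw [norm_mul, Complex.norm_natCast]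
  calc (n : ℝ) * _ ≤ n * (‖z‖ ^ 3 / (n : ℝ) ^ 2) := by gcongr
    _ = _ := by field_simp

theorem tendsto_mulLogAntidiff {z : ℂ} (hz : z ∈ Complex.slitPlane) :
    Tendsto (fun N : ℕ => mulLogAntidiff (z + N) -
      ((∑ k ∈ Finset.range N, ((k : ℝ) + 1) * Real.log (k + 1) : ℝ) : ℂ) -
      z * (Real.log N.factorial : ℝ) - N * z - z ^ 2 / 2 * (harmonic N : ℂ)) atTop
      (𝓝 (-(Real.log glaisher : ℝ) - z / 2 * (Real.log (2 * Real.pi) : ℝ) -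
        (Real.eulerMascheroniConstant : ℂ) * z ^ 2 / 2 + z / 2 + z ^ 2 / 2)) := by
  have t1 := (Complex.continuous_ofReal.tendsto _).comp tendsto_sum_mul_log_glaisher
  have t2 := (Complex.continuous_ofReal.tendsto _).comp tendsto_log_factorial
  have t3 := (Complex.continuous_ofReal.tendsto _).comp Real.tendsto_harmonic_sub_log
  have t4 := tendsto_natCast_mul_log z
  have t0 : Tendsto (fun n : ℕ => 1 / (n : ℂ)) atTop (𝓝 0) :=
    tendsto_one_div_atTop_nhds_zero_nat (𝕜 := ℂ)
  have t5 : Tendsto (fun n : ℕ => (n : ℂ) * Complex.log (1 + z / n)) atTop (𝓝 z) := by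
    have h := ((t4.mul t0).add_const z).sub (t0.const_mul (z ^ 2 / 2))
    simp only [mul_zero, zero_add, sub_zero] at h
    refine h.congr' ?_
    filter_upwards [eventually_ne_atTop 0] with n hn
    have hn' : (n : ℂ) ≠ 0 := by exact_mod_cast hn
    field_simp
    ring
  have t6 : Tendsto (fun n : ℕ => Complex.log (1 + z / n)) atTop (𝓝 0) := by
    have h := t5.mul t0
    simp only [mul_zero] at h
    refine h.congr' ?_
    filter_upwards [eventually_ne_atTop 0] with n hn
    have hn' : (n : ℂ) ≠ 0 := by exact_mod_cast hn
    field_simp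
  -- With `log (z + n) = log n + log (1 + z / n)`, the `log n` parts of the antidifference are
  -- exactly those needed by `t1`, `t2`, `t3`; the `log (1 + z / n)` parts are handled by `t4`,
  -- `t5`, `t6`.
  have h := (((((t1.neg.sub (t2.const_mul z)).sub (t3.const_mul (z ^ 2 / 2))).add
    (t4.div_const 2)).add (t5.mul_const (1 / 2 + z))).add
    (t6.mul_const (z / 2 + z ^ 2 / 2 + 1 / 12))).sub_const (z ^ 2 / 2)
  convert! h.congr' _ using 2
  · push_cast; ring
  · filter_upwards [eventually_ne_atTop 0] with n hn
    have hn' : (n : ℂ) ≠ 0 := by exact_mod_cast hn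
    have hl : Complex.log (z + n) = Complex.log (1 + z / n) + (Real.log n : ℝ) := by
      rw [log_one_add_div hz hn]; ring
    simp only [Function.comp_apply, mulLogAntidiff, hl]
    push_cast
    field_simp
    ring

theorem glaisher_pos : 0 < glaisher := Real.exp_pos _

theorem G_add_one_eq_prefactor_mul {z : ℂ} (hz : z ∈ Complex.slitPlane)
    (hs : Summable fun n : ℕ => logTerm 0 (z + n)) :
    G (z + 1) = prefactor z * Complex.exp (logRemainder 0 z) := by
  have hX := (summable_log_G_factor z).hasSum.tendsto_sum_nat
  have hY := ((summable_logGammaAddOne z).hasSum.tendsto_sum_nat).const_mul z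
  have hXY := hX.sub hY
  simp_rw [sum_log_G_factor_sub hz] at hXY
  have hD := ((tendsto_mulLogAntidiff hz).add hs.hasSum.tendsto_sum_nat).sub_const
    (mulLogAntidiff z)
  have hu := tendsto_nhds_unique hXY (hD.congr fun N => by ring)
  rw [sub_eq_iff_eq_add] at hu
  have hz0 := Complex.slitPlane_ne_zero hz
  have hA : (glaisher : ℂ)⁻¹ = Complex.exp (-(Real.log glaisher : ℝ)) := by
    rw [Complex.exp_neg, ← Complex.ofReal_exp, Real.exp_log glaisher_pos]
  rw [G_add_one_eq hz, hu, prefactor, hA, Complex.cpow_def_of_ne_zero hz0, ← Complex.exp_add,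
    ← Complex.exp_add, ← Complex.exp_add, ← Complex.exp_add]
  congr 1
  rw [logRemainder, logGammaAddOne, mulLogAntidiff]
  ring

end Barnes
end

/-! ### Expansion of the remainder in sectors -/

noncomputable section
namespace Barnes

/-- The constant is `sin (δ / 2)`. By the law of cosines `‖z + x‖²` is at least `‖z‖² - 2 x ‖z‖ cos
δ + x²`, which exceeds `(1 - cos δ) / 2 * (‖z‖ + x)²` by `(1 + cos δ) / 2 * (‖z‖ - x)²`. -/
theorem exists_mul_norm_add_le_norm_add {δ : ℝ} (h0 : 0 < δ) (hπ : δ < Real.pi) :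
    ∃ c : ℝ, 0 < c ∧ ∀ z : ℂ, |z.arg| < Real.pi - δ → ∀ x : ℝ, 0 ≤ x →
      c * (‖z‖ + x) ≤ ‖z + x‖ := by
  have hcos : Real.cos δ < 1 := by
    rw [← Real.cos_zero]
    exact Real.cos_lt_cos_of_nonneg_of_le_pi le_rfl hπ.le h0
  have hcos' : -1 ≤ Real.cos δ := Real.neg_one_le_cos δ
  refine ⟨√((1 - Real.cos δ) / 2), Real.sqrt_pos.2 (by linarith), fun z hz x hx => ?_⟩
  have harg : -Real.cos δ ≤ Real.cos z.arg := by
    rw [← Real.cos_pi_sub, ← Real.cos_abs z.arg]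
    exact Real.cos_le_cos_of_nonneg_of_le_pi (abs_nonneg _) (by linarith) hz.le
  have hre : -(‖z‖ * Real.cos δ) ≤ z.re := by
    rw [← Complex.norm_mul_cos_arg]
    nlinarith [norm_nonneg z]
  have hsq : ‖z + x‖ ^ 2 = ‖z‖ ^ 2 + 2 * x * z.re + x ^ 2 := by
    rw [Complex.sq_norm, Complex.sq_norm, Complex.normSq_apply, Complex.normSq_apply]
    simp
    ring
  refine le_of_sq_le_sq ?_ (norm_nonneg _)
  rw [mul_pow, Real.sq_sqrt (by linarith), hsq]
  nlinarith [mul_le_mul_of_nonneg_left hre hx,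
    mul_nonneg (by linarith : 0 ≤ 1 + Real.cos δ) (sq_nonneg (‖z‖ - x))]

/-- Of the `q + 2` powers of `‖z‖ + n + x`, `q` are spent on decay in `z` and two on summability in
`n`. -/
theorem norm_invDeriv_le (q : ℕ) {c : ℝ} (hc : 0 < c) {z : ℂ} (hz : 1 ≤ ‖z‖)
    (h : ∀ x : ℝ, 0 ≤ x → c * (‖z‖ + x) ≤ ‖z + x‖) (n : ℕ) {x : ℝ} (hx : 0 ≤ x) :
    ‖invDeriv (q + 1) (z + n + x)‖ ≤
      (q + 1).factorial / c ^ (q + 2) * (‖z‖ ^ q)⁻¹ * (1 / ((n + 1 : ℕ) : ℝ) ^ 2) := by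
  have hn : (0 : ℝ) ≤ n := n.cast_nonneg
  have h1 := h (n + x) (by positivity)
  push_cast at h1
  rw [← add_assoc (z : ℂ)] at h1
  have hz0 : 0 < ‖z‖ := by linarith
  have h2 : c ^ (q + 2) * (‖z‖ ^ q * ((n + 1 : ℕ) : ℝ) ^ 2) ≤ ‖z + n + x‖ ^ (q + 2) := by
    calc c ^ (q + 2) * (‖z‖ ^ q * ((n + 1 : ℕ) : ℝ) ^ 2)
        ≤ c ^ (q + 2) * ((‖z‖ + (n + x)) ^ q * (‖z‖ + (n + x)) ^ 2) := by
          gcongr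
          · linarith
          · push_cast; linarith
      _ = (c * (‖z‖ + (n + x))) ^ (q + 2) := by rw [mul_pow, pow_add]; ring
      _ ≤ _ := by gcongr
  rw [invDeriv, norm_div, norm_mul, norm_pow, norm_pow, norm_neg, norm_one, one_pow, one_mul,
    Complex.norm_natCast]
  calc ((q + 1).factorial : ℝ) / ‖z + n + x‖ ^ (q + 1 + 1)
      ≤ (q + 1).factorial / (c ^ (q + 2) * (‖z‖ ^ q * ((n + 1 : ℕ) : ℝ) ^ 2)) := by gcongr
    _ = _ := by field_simp

theorem exists_norm_logTerm_le (q : ℕ) {c : ℝ} (hc : 0 < c) : ∃ M : ℝ, 0 < M ∧ ∀ z : ℂ, 1 ≤ ‖z‖ →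
    (∀ x : ℝ, 0 ≤ x → c * (‖z‖ + x) ≤ ‖z + x‖) → ∀ n : ℕ,
      ‖logTerm q (z + n)‖ ≤ M * (‖z‖ ^ q)⁻¹ * (1 / ((n + 1 : ℕ) : ℝ) ^ 2) := by
  obtain ⟨M, hM, h⟩ := exists_norm_emInt_le (q + 3)
  refine ⟨M * ((q + 1).factorial / c ^ (q + 2)), by positivity, fun z hz hzx n => ?_⟩
  refine (h _ _ fun x hx => norm_invDeriv_le q hc hz hzx n hx.1).trans_eq ?_
  ring

theorem summable_inv_succ_sq : Summable fun n : ℕ => 1 / ((n + 1 : ℕ) : ℝ) ^ 2 :=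
  (summable_nat_add_iff 1).2 (Real.summable_one_div_nat_pow.2 one_lt_two)

theorem summable_logTerm (q : ℕ) {c : ℝ} (hc : 0 < c) {z : ℂ} (hz : 1 ≤ ‖z‖)
    (h : ∀ x : ℝ, 0 ≤ x → c * (‖z‖ + x) ≤ ‖z + x‖) :
    Summable fun n : ℕ => logTerm q (z + n) := by
  obtain ⟨M, -, hM⟩ := exists_norm_logTerm_le q hc
  exact Summable.of_norm_bounded (summable_inv_succ_sq.mul_left _) (hM z hz h)

theorem exists_norm_logRemainder_le (q : ℕ) {c : ℝ} (hc : 0 < c) : ∃ M : ℝ, ∀ z : ℂ, 1 ≤ ‖z‖ →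
    (∀ x : ℝ, 0 ≤ x → c * (‖z‖ + x) ≤ ‖z + x‖) → ‖logRemainder q z‖ ≤ M * (‖z‖ ^ q)⁻¹ := by
  obtain ⟨M, hM0, hM⟩ := exists_norm_logTerm_le q hc
  refine ⟨M * ∑' n : ℕ, 1 / ((n + 1 : ℕ) : ℝ) ^ 2, fun z hz h => ?_⟩
  have hs := (summable_inv_succ_sq.mul_left (M * (‖z‖ ^ q)⁻¹)).hasSum
  refine (tsum_of_norm_bounded hs (hM z hz h)).trans_eq ?_
  rw [tsum_mul_left]
  ring

theorem logTerm_eq_sub_logTerm_succ (q : ℕ) {z : ℂ}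
    (hz : ∀ x ∈ Set.Icc (0 : ℝ) 1, z + x ≠ 0) :
    logTerm q z = (invDeriv (q + 1) (z + 1) - invDeriv (q + 1) z) *
      ((bernoulli (q + 4) : ℝ) / (q + 4).factorial : ℝ) - logTerm (q + 1) z := by
  have h := emInt_eq_sub_emInt_succ (q + 3)
    (fun x hx => hasDerivAt_comp_add_ofReal (hasDerivAt_invDeriv (q + 1) (hz x hx)))
    (fun x hx => (hasDerivAt_comp_add_ofReal
      (hasDerivAt_invDeriv (q + 2) (hz x hx))).continuousAt.continuousWithinAt)
  rw [bernoulliFun_endpoints_eq_of_ne_one (by omega), bernoulliFun_eval_zero, ← sub_mul] at h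
  simpa [logTerm] using h

theorem logRemainder_eq_sub_logRemainder_succ (q : ℕ) {c : ℝ} (hc : 0 < c) {z : ℂ} (hz : 1 ≤ ‖z‖)
    (h : ∀ x : ℝ, 0 ≤ x → c * (‖z‖ + x) ≤ ‖z + x‖) :
    logRemainder q z = -(invDeriv (q + 1) z *
      ((bernoulli (q + 4) : ℝ) / (q + 4).factorial : ℝ)) - logRemainder (q + 1) z := by
  have hne : ∀ n : ℕ, ∀ x ∈ Set.Icc (0 : ℝ) 1, z + n + x ≠ 0 := by
    intro n x hx h0
    have h1 := h (n + x) (add_nonneg n.cast_nonneg hx.1)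
    push_cast at h1
    rw [← add_assoc (z : ℂ), h0, norm_zero] at h1
    have : 0 < c * (‖z‖ + (n + x)) := by
      have := hx.1
      positivity
    linarith
  have h1 := (summable_logTerm q hc hz h).hasSum.tendsto_sum_nat
  have h2 := (summable_logTerm (q + 1) hc hz h).hasSum.tendsto_sum_nat
  have h3 : Tendsto (fun n : ℕ => invDeriv (q + 1) (z + n)) atTop (𝓝 0) := by
    refine squeeze_zero_norm (fun n => ?_)
      (summable_inv_succ_sq.mul_left (((q + 1).factorial / c ^ (q + 2) * (‖z‖ ^ q)⁻¹ : ℝ))).tendsto_atTop_zero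
    simpa using norm_invDeriv_le q hc hz h n le_rfl
  set β : ℂ := (((bernoulli (q + 4) : ℝ) / (q + 4).factorial : ℝ) : ℂ)
  have h4 : ∀ N : ℕ, ∑ n ∈ Finset.range N, logTerm q (z + n) =
      (invDeriv (q + 1) (z + N) - invDeriv (q + 1) z) * β -
        ∑ n ∈ Finset.range N, logTerm (q + 1) (z + n) := by
    intro N
    induction N with
    | zero => simp
    | succ N ih =>
      rw [Finset.sum_range_succ, Finset.sum_range_succ, ih, logTerm_eq_sub_logTerm_succ q (hne N)]
      rw [Nat.cast_succ, ← add_assoc]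
      simp only [β]
      ring
  simp_rw [h4] at h1
  have h5 := ((h3.sub_const (invDeriv (q + 1) z)).mul_const β).sub h2
  have := tendsto_nhds_unique h1 h5
  rw [logRemainder, this, logRemainder]
  ring

theorem α_eq_mul (r : ℝ) (n : ℕ) : α r n = r * α 1 n := by
  unfold α
  split_ifs
  · simp
  · ring

/-- Two integrations by parts: the second boundary term carries an odd Bernoulli number and
vanishes, which is why only even powers of `1 / z` occur. -/
theorem logRemainder_two_mul (q : ℕ) {c : ℝ} (hc : 0 < c) {z : ℂ} (hz : 1 ≤ ‖z‖)
    (h : ∀ x : ℝ, 0 ≤ x → c * (‖z‖ + x) ≤ ‖z + x‖) :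
    logRemainder (2 * q) z =
      (α 1 (q + 1) : ℂ) * (1 / z ^ 2) ^ (q + 1) + logRemainder (2 * (q + 1)) z := by
  have hodd : bernoulli (2 * q + 1 + 4) = 0 :=
    bernoulli_eq_zero_of_odd ⟨q + 2, by ring⟩ (by omega)
  rw [logRemainder_eq_sub_logRemainder_succ (2 * q) hc hz h,
    logRemainder_eq_sub_logRemainder_succ (2 * q + 1) hc hz h, hodd]
  have hz0 : z ≠ 0 := norm_pos_iff.1 (by linarith)
  have hf : (2 * q + 4).factorial = (2 * q + 4) * ((2 * q + 3) * ((2 * q + 2) *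
      (2 * q + 1).factorial)) := by
    rw [Nat.factorial_succ, Nat.factorial_succ, Nat.factorial_succ]
  have hfp : ((2 * q + 1).factorial : ℂ) ≠ 0 := by exact_mod_cast Nat.factorial_ne_zero _
  have h1 : (q : ℂ) + 1 ≠ 0 := by exact_mod_cast q.succ_ne_zero
  have h2 : (2 * q + 2 : ℂ) ≠ 0 := by exact_mod_cast (2 * q + 1).succ_ne_zero
  have h3 : (2 * q + 3 : ℂ) ≠ 0 := by exact_mod_cast (2 * q + 2).succ_ne_zero
  have h4 : (2 * q + 4 : ℂ) ≠ 0 := by exact_mod_cast (2 * q + 3).succ_ne_zero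
  rw [invDeriv, α, if_neg q.succ_ne_zero, hf, show 2 * (q + 1) + 2 = 2 * q + 4 by ring,
    show 2 * q + 1 + 1 = 2 * (q + 1) by ring]
  have hm : (-1 : ℂ) ^ (2 * q + 1) = -1 := by rw [pow_succ, pow_mul]; simp
  rw [hm, div_pow, one_pow, ← pow_mul]
  push_cast
  rw [show (2 : ℂ) * (q + 1) = 2 * q + 2 by ring, show (2 : ℂ) * q + 2 + 1 = 2 * q + 3 by ring,
    show (2 : ℂ) * q + 2 + 2 = 2 * q + 4 by ring]
  field_simp
  ring

theorem logRemainder_zero_eq_sum (N : ℕ) {c : ℝ} (hc : 0 < c) {z : ℂ} (hz : 1 ≤ ‖z‖)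
    (h : ∀ x : ℝ, 0 ≤ x → c * (‖z‖ + x) ≤ ‖z + x‖) :
    logRemainder 0 z = ∑ n ∈ Finset.range (N + 1), (α 1 n : ℂ) * (1 / z ^ 2) ^ n +
      logRemainder (2 * N) z := by
  induction N with
  | zero => simp [α]
  | succ N ih => rw [Finset.sum_range_succ, ih, logRemainder_two_mul N hc hz h]; ring

theorem eventually_sectorAtInfinity {δ : ℝ} (hδ : 0 < δ) : ∃ c : ℝ, 0 < c ∧
    ∀ᶠ z in sectorAtInfinity δ, 1 ≤ ‖z‖ ∧ z ∈ Complex.slitPlane ∧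
      ∀ x : ℝ, 0 ≤ x → c * (‖z‖ + x) ≤ ‖z + x‖ := by
  -- Capping `δ` only enlarges the sector, and keeps the angle below `π` when `δ` is large.
  obtain ⟨c, hc, h⟩ := exists_mul_norm_add_le_norm_add (δ := min δ (Real.pi / 2))
    (lt_min hδ (by positivity)) ((min_le_right _ _).trans_lt (by linarith [Real.pi_pos]))
  refine ⟨c, hc, ?_⟩
  have h1 : ∀ᶠ z in sectorAtInfinity δ, 1 ≤ ‖z‖ :=
    Eventually.filter_mono inf_le_left (tendsto_norm_cobounded_atTop.eventually_ge_atTop 1)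
  have h2 : ∀ᶠ z in sectorAtInfinity δ, |z.arg| < Real.pi - δ :=
    Eventually.filter_mono inf_le_right (eventually_principal.2 fun z hz => hz)
  filter_upwards [h1, h2] with z hz1 hz2
  refine ⟨hz1, ?_, h z (hz2.trans_le (by linarith [min_le_left δ (Real.pi / 2)]))⟩
  rw [Complex.mem_slitPlane_iff_arg]
  refine ⟨fun he => ?_, norm_pos_iff.1 (by linarith)⟩
  rw [he, abs_of_pos Real.pi_pos] at hz2
  linarith

theorem tendsto_one_div_sq_sectorAtInfinity (δ : ℝ) :
    Tendsto (fun z : ℂ => 1 / z ^ 2) (sectorAtInfinity δ) (𝓝 0) := by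
  have h := (tendsto_inv₀_cobounded (α := ℂ)).pow 2
  rw [zero_pow two_ne_zero] at h
  refine (h.mono_left inf_le_left).congr fun z => ?_
  rw [inv_pow, one_div]

theorem logRemainder_hasExpansion {δ : ℝ} (hδ : 0 < δ) (r : ℝ) (N : ℕ) :
    (fun z : ℂ => r * logRemainder 0 z -
      ∑ n ∈ Finset.range N, (α r n : ℂ) * (1 / z ^ 2) ^ n) =O[sectorAtInfinity δ]
      fun z : ℂ => (1 / z ^ 2) ^ N := by
  obtain ⟨c, hc, h⟩ := eventually_sectorAtInfinity hδ
  obtain ⟨M, hM⟩ := exists_norm_logRemainder_le (2 * N) hc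
  have h1 : logRemainder (2 * N) =O[sectorAtInfinity δ] fun z : ℂ => (1 / z ^ 2) ^ N := by
    refine IsBigO.of_bound M ?_
    filter_upwards [h] with z hz
    refine (hM z hz.1 hz.2.2).trans_eq ?_
    rw [norm_pow, norm_div, norm_one, norm_pow, one_div, inv_pow, ← pow_mul]
  -- `logRemainder_zero_eq_sum` also produces the term of index `N`, which belongs to the error.
  refine (((isBigO_refl (fun z : ℂ => (1 / z ^ 2) ^ N) _).const_mul_left (α r N : ℂ)).add
    (h1.const_mul_left (r : ℂ))).congr' ?_ EventuallyEq.rfl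
  filter_upwards [h] with z hz
  rw [logRemainder_zero_eq_sum N hc hz.1 hz.2.2, Finset.sum_range_succ, mul_add, mul_add,
    Finset.mul_sum]
  simp_rw [α_eq_mul r]
  push_cast
  simp_rw [mul_assoc]
  ring

/-! ### Exponentials of asymptotic power series -/

section Exp

open Polynomial in
/-- Polynomials agree with their truncations up to the order of truncation. -/
theorem isBigO_aeval_sub_sum {l : Filter ℂ} {w : ℂ → ℂ} (hw : Tendsto w l (𝓝 0)) (Q : ℝ[X])
    (N : ℕ) : (fun z => aeval (w z) Q - ∑ n ∈ Finset.range N, (Q.coeff n : ℂ) * w z ^ n) =O[l]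
      fun z => w z ^ N := by
  set M := max N (Q.natDegree + 1)
  have hlt : Q.natDegree < M := lt_of_lt_of_le (Nat.lt_succ_self _) (le_max_right _ _)
  have h : (fun z => ∑ n ∈ Finset.Ico N M, (Q.coeff n : ℂ) * w z ^ n) =O[l]
      fun z => w z ^ N := by
    refine IsBigO.fun_sum fun n hn => IsBigO.const_mul_left ?_ _
    rw [Finset.mem_Ico] at hn
    obtain ⟨k, rfl⟩ := Nat.exists_eq_add_of_le hn.1
    have := (isBigO_refl (fun z => w z ^ N) l).mul ((hw.pow k).isBigO_one ℂ)
    simpa [pow_add] using this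
  refine h.congr (fun z => ?_) fun z => rfl
  rw [aeval_eq_sum_range' hlt, Finset.range_eq_Ico, Finset.range_eq_Ico,
    ← Finset.sum_Ico_consecutive _ (Nat.zero_le N) (le_max_left _ _)]
  simp [M]

variable {a : ℕ → ℝ}

theorem coeff_pow_mk_eq_zero (ha : a 0 = 0) {n j : ℕ} (h : n < j) :
    PowerSeries.coeff n ((PowerSeries.mk a) ^ j) = 0 := by
  have h1 : PowerSeries.X ∣ PowerSeries.mk a := by
    rw [PowerSeries.X_dvd_iff, ← PowerSeries.coeff_zero_eq_constantCoeff_apply,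
      PowerSeries.coeff_mk, ha]
  exact PowerSeries.X_pow_dvd_iff.1 (pow_dvd_pow_of_dvd h1 j) n h

-- As `a 0 = 0`, the `j`-th power of the series starts at degree `j`, so only `j < N` matter below
-- degree `N`; truncating the series at `N` leaves those coefficients unchanged.
open Polynomial in
theorem coeff_sum_trunc_pow (ha : a 0 = 0) {n N : ℕ} (hn : n < N) :
    (∑ j ∈ Finset.range N, C ((j.factorial : ℝ)⁻¹) *
      (PowerSeries.trunc N (PowerSeries.mk a)) ^ j).coeff n =
      PowerSeries.coeff n ((PowerSeries.exp ℝ).subst (PowerSeries.mk a)) := by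
  have hs : PowerSeries.HasSubst (PowerSeries.mk a) :=
    PowerSeries.HasSubst.of_constantCoeff_zero' (by
      rw [← PowerSeries.coeff_zero_eq_constantCoeff_apply, PowerSeries.coeff_mk, ha])
  rw [PowerSeries.coeff_subst' hs, finsum_eq_sum_of_support_subset (s := Finset.range N), finsetSum_coeff]
  · refine Finset.sum_congr rfl fun j _ => ?_
    have h := congrArg (fun p => Polynomial.coeff p n)
      (PowerSeries.trunc_trunc_pow (PowerSeries.mk a) N j)
    simp only [PowerSeries.coeff_trunc, if_pos hn] at h
    rw [← Polynomial.coe_pow, Polynomial.coeff_coe] at h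
    rw [coeff_C_mul, h, PowerSeries.coeff_exp]
    simp
  · intro j hj
    simp only [Function.mem_support] at hj
    simp only [Finset.coe_range, Set.mem_Iio]
    by_contra hjN
    exact hj (by rw [coeff_pow_mk_eq_zero ha (by omega), smul_zero])

/-- The exponential of a function with an asymptotic power series has the formal exponential of
that series as its asymptotic power series. -/
theorem exp_hasExpansion {l : Filter ℂ} {w L : ℂ → ℂ} (hw : Tendsto w l (𝓝 0)) (ha : a 0 = 0)
    (hL : ∀ N : ℕ, (fun z => L z - ∑ n ∈ Finset.range N, (a n : ℂ) * w z ^ n) =O[l]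
      fun z => w z ^ N) (N : ℕ) :
    (fun z => Complex.exp (L z) - ∑ n ∈ Finset.range N, ((PowerSeries.coeff n
      ((PowerSeries.exp ℝ).subst (PowerSeries.mk a)) : ℝ) : ℂ) * w z ^ n) =O[l]
      fun z => w z ^ N := by
  have hL1 : L =O[l] w := by simpa [ha] using hL 1
  have hL0 : Tendsto L l (𝓝 0) := hL1.trans_tendsto hw
  -- Three errors of order `w ^ N` are added: cutting the exponential series, replacing `L` by the
  -- polynomial `p` in `w`, and cutting the resulting polynomial at degree `N`.
  have hexp := ((Complex.exp_sub_sum_range_isBigO_pow N).comp_tendsto hL0).trans (hL1.pow N)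
  set p := PowerSeries.trunc N (PowerSeries.mk a) with hp
  have hpe : ∀ z, Polynomial.aeval (w z) p = ∑ n ∈ Finset.range N, (a n : ℂ) * w z ^ n := by
    intro z
    rw [Polynomial.aeval_def, PowerSeries.eval₂_trunc_eq_sum_range]
    simp
  have hd : (fun z => L z - Polynomial.aeval (w z) p) =O[l] fun z => w z ^ N := by
    simpa only [hpe] using hL N
  have hp0 : (fun z => Polynomial.aeval (w z) p) =O[l] fun _ => (1 : ℂ) := by
    have := (p.continuous_aeval (A := ℂ)).tendsto 0 |>.comp hw
    exact this.isBigO_one ℂ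
  have hpow : ∀ j : ℕ, (fun z => L z ^ j - Polynomial.aeval (w z) p ^ j) =O[l]
      fun z => w z ^ N := by
    intro j
    induction j with
    | zero => simpa using isBigO_zero _ _
    | succ j ih =>
      have h1 := ((hL0.pow j).isBigO_one ℂ).mul hd
      have h2 := ih.mul hp0
      simp only [one_mul, mul_one] at h1 h2
      refine (h1.add h2).congr (fun z => ?_) fun z => rfl
      ring
  have hsum : (fun z => ∑ j ∈ Finset.range N, (j.factorial : ℂ)⁻¹ *
      (L z ^ j - Polynomial.aeval (w z) p ^ j)) =O[l] fun z => w z ^ N :=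
    IsBigO.fun_sum fun j _ => (hpow j).const_mul_left _
  have hQ := isBigO_aeval_sub_sum hw (∑ j ∈ Finset.range N, Polynomial.C ((j.factorial : ℝ)⁻¹) *
    p ^ j) N
  refine ((hexp.add hsum).add hQ).congr (fun z => ?_) fun z => rfl
  have hc : ∑ n ∈ Finset.range N, ((∑ j ∈ Finset.range N, Polynomial.C ((j.factorial : ℝ)⁻¹) *
      p ^ j).coeff n : ℂ) * w z ^ n = ∑ n ∈ Finset.range N, ((PowerSeries.coeff n
      ((PowerSeries.exp ℝ).subst (PowerSeries.mk a)) : ℝ) : ℂ) * w z ^ n :=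
    Finset.sum_congr rfl fun n hn => by
      rw [hp, coeff_sum_trunc_pow ha (Finset.mem_range.1 hn)]
  rw [hc]
  simp only [Function.comp_apply, map_sum, map_mul, map_pow, Polynomial.aeval_C, mul_sub,
    Finset.sum_sub_distrib, div_eq_inv_mul, Complex.coe_algebraMap, Complex.ofReal_inv,
    Complex.ofReal_natCast]
  ring

end Exp

/-- The bound keeps the imaginary part of `r * s` in the principal strip, so `log (exp (r * s)) = r
* s`. -/
theorem exp_cpow_one_div {r : ℝ} (hr : r ≠ 0) {s : ℂ} (hs : ‖r * s‖ < Real.pi) :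
    Complex.exp (r * s) ^ (1 / (r : ℂ)) = Complex.exp s := by
  have him := abs_lt.1 ((Complex.abs_im_le_norm _).trans_lt hs)
  have hr' : (r : ℂ) ≠ 0 := by exact_mod_cast hr
  rw [Complex.cpow_def_of_ne_zero (Complex.exp_ne_zero _), Complex.log_exp him.1 him.2.le]
  congr 1
  field_simp

end Barnes
end

/-! ### The main theorem -/

theorem theorem1p1 (r : ℝ) (hr : r ≠ 0) :
    (∃ R : ℂ → ℂ,
      (∀ δ : ℝ, 0 < δ → ∀ᶠ z in Barnes.sectorAtInfinity δ,
        Barnes.G (z + 1) = Barnes.prefactor z * R z ^ (1 / (r : ℂ))) ∧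
      Barnes.HasEvenAsymptoticExpansion R (Barnes.b r)) ∧
    ∀ m : ℕ, 0 < m →
      (fun n : ℕ => Barnes.b r n - ∑ k ∈ Finset.range m, Barnes.b r k * Barnes.α r (n - k))
        =O[atTop] fun n : ℕ => Barnes.α r (n - m) := by
  have hα0 : Barnes.α r 0 = 0 := if_pos rfl
  refine ⟨⟨fun z => Complex.exp (r * Barnes.logRemainder 0 z), fun δ hδ => ?_, fun δ hδ N => ?_⟩,
    Barnes.isBigO_b_sub_sum hr⟩
  · obtain ⟨c, hc, h⟩ := Barnes.eventually_sectorAtInfinity hδ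
    -- Order one suffices here: since `α r 0 = 0`, it says that `r * logRemainder 0 z` tends to `0`,
    -- so its norm is eventually below `π`.
    have hO := Barnes.logRemainder_hasExpansion hδ r 1
    simp only [Finset.sum_range_one, hα0, Complex.ofReal_zero, zero_mul, sub_zero, pow_one] at hO
    have ht := (hO.trans_tendsto (Barnes.tendsto_one_div_sq_sectorAtInfinity δ)).norm
    rw [norm_zero] at ht
    filter_upwards [h, ht.eventually_lt_const Real.pi_pos] with z hz hz'
    rw [Barnes.exp_cpow_one_div hr hz', Barnes.G_add_one_eq_prefactor_mul hz.2.1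
      (Barnes.summable_logTerm 0 hc hz.1 hz.2.2)]
  · have h := Barnes.exp_hasExpansion (Barnes.tendsto_one_div_sq_sectorAtInfinity δ) hα0
      (Barnes.logRemainder_hasExpansion hδ r) N
    refine h.congr (fun z => ?_) fun z => ?_
    · simp only [Barnes.b, one_div_pow, ← pow_mul, mul_one_div]
    · rw [one_div_pow, ← pow_mul]
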